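/- Let $R$ be a countable integral domain; all modules are $R$-modules. A tower of countable modules $\boldsymbol A$ consists of countable modules $A^{(n)}$ ($n\in\omega$) and homomorphisms $p^{(n,m)}\colon A^{(m)}\to A^{(n)}$ ($n\le m$) with $p^{(n,n)}=\mathrm{id}$ and $p^{(n,m)}p^{(m,k)}=p^{(n,k)}$. Morphisms of towers are those of the category of pro-modules: $\mathrm{Hom}(\boldsymbol A,\boldsymbol B)=\lim_i\mathrm{colim}_j\mathrm{Hom}(A^{(j)},B^{(i)})$, and $\cong$ is isomorphism in this category. A tower is reduced if $\lim\boldsymbol A=0$, and essentially monomorphic if it is isomorphic to a tower of countable modules whose maps $p^{(n,n+1)}$ are all injective. Modules with a Polish cover. A Polish module is a module with a Polish group topology for which every $x\mapsto rx$, $r\in R$, is continuous. A submodule $N$ of a Polish module $\hat G$ is Polishable if it has a (necessarily unique) Polish module topology for which the inclusion $N\to\hat G$ is continuous. A module with a Polish cover is a quotient $G=\hat G/N$ with $\hat G$ a Polish module and $N$ a Polishable submodule; its submodules with a Polish cover are the $\hat H/N$ with $N\subseteq\hat H\subseteq\hat G$ and $\hat H$ Polishable, and $\hat H/N$ is said to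 be $\boldsymbol\Sigma^0_2$ or $\boldsymbol\Pi^0_3$ in $G$ if $\hat H$ is so in $\hat G$. Such an $\hat H/N$ is again a module with a Polish cover, $\hat H$ carrying its Polish module topology. Let $s_1(G)$ be the smallest $\boldsymbol\Pi^0_3$ submodule with a Polish cover of $G$, and let $s_0(G)=\overline{\{0\}}$, $s_{\alpha+1}(G)=s_1(s_\alpha(G))$, and $s_\lambda(G)=\bigcap_{\beta<\lambda}s_\beta(G)$ for $\lambda$ limit: the Solecki submodules of $G$. The Solecki length of $G$ is the least $\alpha$ with $s_\alpha(G)=0$. For a successor $\alpha$, $G$ has plain Solecki length at most $\alpha$ if it has Solecki length at most $\alpha$ and $\{0\}$ is $\boldsymbol\Sigma^0_2$ in $s_{\alpha-1}(G)$. The functor $\lim^1$. Let $Z^1$ be the module of the families $c=(c_{l_0l_1})\in\prod_{l_0\le l_1}A^{(l_0)}$ with $p^{(l_0,l_1)}(c_{l_1l_2})-c_{l_0l_2}+c_{l_0l_1}=0$ for all $l_0\le l_1\le l_2$, with the topology induced by the product of the discrete topologies, and let $B^1\subseteq Z^1$ be the submodule of the families $\bigl(p^{(l_0,l_1)}(b_{l_1})-b_{l_0}\bigr)_{l_0\le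 l_1}$ with $(b_n)\in\prod_nA^{(n)}$. Then $\lim^1\boldsymbol A=Z^1/B^1$ is a module with a Polish cover, whose trivial submodule is dense. Derived towers. For every limit ordinal $\lambda<\omega_1$ fix a strictly increasing sequence $(\lambda_n)$ of successor ordinals with supremum $\lambda$. The derived towers $\boldsymbol A_\alpha=(A_\alpha^{(n)})_{n\in\omega}$, $\alpha<\omega_1$, are the subtowers of $\boldsymbol A$ given by $A^{(n)}_0=A^{(n)}$, $A^{(n)}_{\beta+1}=\bigcap_{k\in\omega}p^{(n,n+k)}\bigl(A^{(n+k)}_\beta\bigr)$, and $A^{(n)}_\lambda=A^{(n)}_{\lambda_n}$ for $\lambda$ limit. A reduced tower $\boldsymbol A$ has length at most $\alpha$ if $\boldsymbol A_\alpha\cong0$; for a successor $\alpha$, it has plain length at most $\alpha$ if $\boldsymbol A_{\alpha-1}$ is essentially monomorphic. Theorem. Let $\boldsymbol A$ be a tower of countable modules and $\alpha<\omega_1$. (1) The homomorphism $\lim^1\boldsymbol A_\alpha\to\lim^1\boldsymbol A$ induced by the inclusion is injective and its image is $s_\alpha(\lim^1\boldsymbol A)$; that is, $s_\alpha(\lim^1\boldsymbol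 A)=\lim^1\boldsymbol A_\alpha$. (2) If $\boldsymbol A$ is reduced, then $\boldsymbol A$ has length at most $\alpha$ if and only if $\lim^1\boldsymbol A$ has Solecki length at most $\alpha$. (3) If $\boldsymbol A$ is reduced and $\alpha$ is a successor ordinal, then $\boldsymbol A$ has plain length at most $\alpha$ if and only if $\lim^1\boldsymbol A$ has plain Solecki length at most $\alpha$. -/

import Mathlib

open Ordinal
open scoped Topology

universe u v

noncomputable section

/-! ### Polish modules and modules with a Polish cover -/

/-- A Polish `R`-module: a Polish abelian group on which every `r : R` acts continuously. -/
structure IsPolishModule (R : Type v) (M : Type u) [CommRing R] [AddCommGroup M] [Module R M]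
    [TopologicalSpace M] : Prop where
  polish : PolishSpace M
  addGroup : IsTopologicalAddGroup M
  smul : ContinuousConstSMul R M

/-- `τ` is a Polish module topology on the submodule `H` for which the inclusion of `H` in the
ambient module is continuous. (When the ambient module is Polish, there is at most one such `τ`.) -/
def IsPolishTopologyOn {R : Type v} {M : Type u} [CommRing R] [AddCommGroup M] [Module R M]
    [TopologicalSpace M] (H : Submodule R M) (τ : TopologicalSpace H) : Prop :=
  @IsPolishModule R H _ _ _ τ ∧ @Continuous H M τ _ H.subtype

/-- Polishable submodules. -/
def IsPolishable {R : Type v} {M : Type u} [CommRing R] [AddCommGroup M] [Module R M]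
    [TopologicalSpace M] (H : Submodule R M) : Prop :=
  ∃ τ : TopologicalSpace H, IsPolishTopologyOn H τ

/-- `Σ⁰₂` sets: countable unions of closed sets. -/
def IsSigma02 {X : Type u} [TopologicalSpace X] (s : Set X) : Prop :=
  ∃ F : ℕ → Set X, (∀ n, IsClosed (F n)) ∧ s = ⋃ n, F n

/-- `Π⁰₃` sets: countable intersections of `Σ⁰₂` sets. -/
def IsPi03 {X : Type u} [TopologicalSpace X] (s : Set X) : Prop :=
  ∃ S : ℕ → Set X, (∀ n, IsSigma02 (S n)) ∧ s = ⋂ n, S n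

/-- For `K ≤ H`, with `H` Polishable: `K` is `Σ⁰₂` in `H`, where `H` carries its Polish module
topology. -/
def IsSigma02In {R : Type v} {M : Type u} [CommRing R] [AddCommGroup M] [Module R M]
    [TopologicalSpace M] (K H : Submodule R M) : Prop :=
  ∃ τ : TopologicalSpace H, IsPolishTopologyOn H τ ∧ @IsSigma02 H τ {x : H | (x : M) ∈ K}

/-- For `K ≤ H`, with `H` Polishable: `K` is `Π⁰₃` in `H`, where `H` carries its Polish module
topology. -/
def IsPi03In {R : Type v} {M : Type u} [CommRing R] [AddCommGroup M] [Module R M]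
    [TopologicalSpace M] (K H : Submodule R M) : Prop :=
  ∃ τ : TopologicalSpace H, IsPolishTopologyOn H τ ∧ @IsPi03 H τ {x : H | (x : M) ∈ K}

/-- For Polishable submodules `N ≤ H` of a Polish module, `firstSolecki N H` is the submodule
`K ≥ N` of `H` such that `K / N = s₁(H / N)`, the smallest submodule with a Polish cover of `H / N`
that is `Π⁰₃` in `H / N` (when a smallest one exists, it is the intersection of all of them). -/
def firstSolecki {R : Type v} {M : Type u} [CommRing R] [AddCommGroup M] [Module R M]
    [TopologicalSpace M] (N H : Submodule R M) : Submodule R M :=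
  sInf {K | N ≤ K ∧ K ≤ H ∧ IsPolishable K ∧ IsPi03In K H}

/-- A module with a Polish cover: a quotient `Cover / N` with `Cover` a Polish module and `N` a
Polishable submodule. -/
structure ModuleWithPolishCover (R : Type v) [CommRing R] where
  Cover : Type u
  [addCommGroup : AddCommGroup Cover]
  [module : Module R Cover]
  [topology : TopologicalSpace Cover]
  isPolishModule : IsPolishModule R Cover
  N : Submodule R Cover
  isPolishable : IsPolishable N

namespace ModuleWithPolishCover

attribute [instance] addCommGroup module topology

variable {R : Type v} [CommRing R] (G : ModuleWithPolishCover.{u} R)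

instance : IsTopologicalAddGroup G.Cover := G.isPolishModule.addGroup

instance : ContinuousConstSMul R G.Cover := G.isPolishModule.smul

/-- The underlying module `Cover / N`. -/
abbrev Quot : Type u := G.Cover ⧸ G.N

/-- The submodule of `Cover` that contains `N` and whose quotient by `N` is the `α`-th Solecki
submodule: `s₀` is the closure of `0`, `s_{α+1}(G) = s₁(s_α(G))`, and `s_λ(G)` is the intersection
of the `s_β(G)` for `β < λ` when `λ` is limit. -/
def soleckiCover (α : Ordinal.{0}) : Submodule R G.Cover :=
  Ordinal.limitRecOn α G.N.topologicalClosure (fun _ H => firstSolecki G.N H)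
    (fun o _ ih => ⨅ β : Set.Iio o, ih β.1 β.2)

/-- The `α`-th Solecki submodule `s_α(G)` of `G`. -/
def solecki (α : Ordinal.{0}) : Submodule R G.Quot :=
  (G.soleckiCover α).map G.N.mkQ

/-- `G` has Solecki length at most `α`: the least `σ` with `s_σ(G) = 0` is at most `α`. -/
def SoleckiLengthLE (α : Ordinal.{0}) : Prop :=
  ∃ σ ≤ α, G.solecki σ = ⊥

/-- `G` has plain Solecki length at most `α`, where `α` is a successor: it has Solecki length at
most `α`, and `{0}` is `Σ⁰₂` in `s_{α-1}(G)`. -/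
def PlainSoleckiLengthLE (α : Ordinal.{0}) : Prop :=
  ∃ β, α = β + 1 ∧ G.SoleckiLengthLE α ∧ IsSigma02In G.N (G.soleckiCover β)

end ModuleWithPolishCover

/-! ### Towers -/

/-- Towers (inverse sequences) of `R`-modules. -/
structure Tower (R : Type v) [CommRing R] where
  obj : ℕ → Type u
  [addCommGroup : ∀ n, AddCommGroup (obj n)]
  [module : ∀ n, Module R (obj n)]
  p : ∀ {n m : ℕ}, n ≤ m → obj m →ₗ[R] obj n
  p_self : ∀ {n : ℕ} (h : n ≤ n) (x : obj n), p h x = x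
  p_comp : ∀ {n m k : ℕ} (h : n ≤ m) (h' : m ≤ k) (x : obj k), p h (p h' x) = p (h.trans h') x

namespace Tower

attribute [instance] Tower.addCommGroup Tower.module
attribute [simp] Tower.p_self Tower.p_comp

variable {R : Type v} [CommRing R]

section Complex

variable (A : Tower.{u} R)

/-- `K⁰(A) = ∏ₙ A⁽ⁿ⁾`. -/
def K0 : Type u := ∀ n : ℕ, A.obj n

/-- `K¹(A)`, the product of the `A⁽ˡ⁰⁾` over the pairs `l₀ ≤ l₁`. -/
def K1 : Type u := ∀ l : {l : ℕ × ℕ // l.1 ≤ l.2}, A.obj l.1.1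

/-- `K²(A)`, the product of the `A⁽ˡ⁰⁾` over the triples `l₀ ≤ l₁ ≤ l₂`. -/
def K2 : Type u := ∀ l : {l : ℕ × ℕ × ℕ // l.1 ≤ l.2.1 ∧ l.2.1 ≤ l.2.2}, A.obj l.1.1

instance : AddCommGroup A.K0 := inferInstanceAs (AddCommGroup (∀ n : ℕ, A.obj n))
instance : Module R A.K0 := inferInstanceAs (Module R (∀ n : ℕ, A.obj n))
instance : AddCommGroup A.K1 :=
  inferInstanceAs (AddCommGroup (∀ l : {l : ℕ × ℕ // l.1 ≤ l.2}, A.obj l.1.1))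
instance : Module R A.K1 :=
  inferInstanceAs (Module R (∀ l : {l : ℕ × ℕ // l.1 ≤ l.2}, A.obj l.1.1))
instance : AddCommGroup A.K2 := inferInstanceAs
  (AddCommGroup (∀ l : {l : ℕ × ℕ × ℕ // l.1 ≤ l.2.1 ∧ l.2.1 ≤ l.2.2}, A.obj l.1.1))
instance : Module R A.K2 := inferInstanceAs
  (Module R (∀ l : {l : ℕ × ℕ × ℕ // l.1 ≤ l.2.1 ∧ l.2.1 ≤ l.2.2}, A.obj l.1.1))

/-- The product topology, where every `A⁽ⁿ⁾` is discrete. -/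
instance : TopologicalSpace A.K0 := @Pi.topologicalSpace ℕ A.obj (fun _ => ⊥)

/-- The product topology, where every `A⁽ⁿ⁾` is discrete. -/
instance : TopologicalSpace A.K1 :=
  @Pi.topologicalSpace {l : ℕ × ℕ // l.1 ≤ l.2} (fun l => A.obj l.1.1) (fun _ => ⊥)

/-- The coboundary `K⁰(A) → K¹(A)`. -/
def d1 : A.K0 →ₗ[R] A.K1 where
  toFun b l := A.p l.2 (b l.1.2) - b l.1.1
  map_add' b c := by
    funext l
    change A.p l.2 (b l.1.2 + c l.1.2) - (b l.1.1 + c l.1.1) =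
      (A.p l.2 (b l.1.2) - b l.1.1) + (A.p l.2 (c l.1.2) - c l.1.1)
    rw [map_add]; abel
  map_smul' r b := by
    funext l
    change A.p l.2 (r • b l.1.2) - r • b l.1.1 = r • (A.p l.2 (b l.1.2) - b l.1.1)
    rw [map_smul, smul_sub]

/-- The coboundary `K¹(A) → K²(A)`. -/
def d2 : A.K1 →ₗ[R] A.K2 where
  toFun c l := A.p l.2.1 (c ⟨(l.1.2.1, l.1.2.2), l.2.2⟩)
    - c ⟨(l.1.1, l.1.2.2), l.2.1.trans l.2.2⟩ + c ⟨(l.1.1, l.1.2.1), l.2.1⟩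
  map_add' b c := by
    funext l
    change A.p l.2.1 (b ⟨(l.1.2.1, l.1.2.2), l.2.2⟩ + c ⟨(l.1.2.1, l.1.2.2), l.2.2⟩)
      - (b ⟨(l.1.1, l.1.2.2), l.2.1.trans l.2.2⟩ + c ⟨(l.1.1, l.1.2.2), l.2.1.trans l.2.2⟩)
      + (b ⟨(l.1.1, l.1.2.1), l.2.1⟩ + c ⟨(l.1.1, l.1.2.1), l.2.1⟩) =
      (A.p l.2.1 (b ⟨(l.1.2.1, l.1.2.2), l.2.2⟩)
        - b ⟨(l.1.1, l.1.2.2), l.2.1.trans l.2.2⟩ + b ⟨(l.1.1, l.1.2.1), l.2.1⟩) +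
      (A.p l.2.1 (c ⟨(l.1.2.1, l.1.2.2), l.2.2⟩)
        - c ⟨(l.1.1, l.1.2.2), l.2.1.trans l.2.2⟩ + c ⟨(l.1.1, l.1.2.1), l.2.1⟩)
    rw [map_add]; abel
  map_smul' r c := by
    funext l
    change A.p l.2.1 (r • c ⟨(l.1.2.1, l.1.2.2), l.2.2⟩)
      - r • c ⟨(l.1.1, l.1.2.2), l.2.1.trans l.2.2⟩ + r • c ⟨(l.1.1, l.1.2.1), l.2.1⟩ =
      r • (A.p l.2.1 (c ⟨(l.1.2.1, l.1.2.2), l.2.2⟩)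
        - c ⟨(l.1.1, l.1.2.2), l.2.1.trans l.2.2⟩ + c ⟨(l.1.1, l.1.2.1), l.2.1⟩)
    rw [map_smul, smul_add, smul_sub]

theorem d2_d1 (b : A.K0) : A.d2 (A.d1 b) = 0 := by
  funext l
  change A.p l.2.1 (A.p l.2.2 (b l.1.2.2) - b l.1.2.1)
    - (A.p (l.2.1.trans l.2.2) (b l.1.2.2) - b l.1.1) + (A.p l.2.1 (b l.1.2.1) - b l.1.1) = 0
  rw [map_sub, A.p_comp]; abel

/-- `lim A = H⁰(K(A))`. -/
def lim : Submodule R A.K0 := LinearMap.ker A.d1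

/-- The 1-cocycles `Z¹(K(A))`, with the topology of a closed submodule of `K¹(A)`. -/
abbrev Z1 : Submodule R A.K1 := LinearMap.ker A.d2

/-- The coboundary `K⁰(A) → Z¹(K(A))`. -/
def d1Z : A.K0 →ₗ[R] A.Z1 := A.d1.codRestrict A.Z1 (fun b => A.d2_d1 b)

/-- The 1-coboundaries `B¹(K(A))`, as a submodule of the 1-cocycles. -/
abbrev B1 : Submodule R A.Z1 := LinearMap.range A.d1Z

end Complex

/-! #### `Z¹` is a Polish module and `B¹` is Polishable -/

section Polish

theorem isPolishModule_pi {ι : Type} [Countable ι] (M : ι → Type u) [∀ i, AddCommGroup (M i)]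
    [∀ i, Module R (M i)] [∀ i, Countable (M i)] :
    @IsPolishModule R (∀ i, M i) _ _ _ (@Pi.topologicalSpace ι M (fun _ => ⊥)) := by
  let _ : ∀ i, TopologicalSpace (M i) := fun _ => ⊥
  have : ∀ i, DiscreteTopology (M i) := fun _ => ⟨rfl⟩
  have : ∀ i, ContinuousConstSMul R (M i) := fun _ => ⟨fun _ => continuous_of_discreteTopology⟩
  exact ⟨inferInstance, inferInstance, inferInstance⟩

variable (A : Tower.{u} R)

theorem isPolishModule_K0 [∀ n, Countable (A.obj n)] : IsPolishModule R A.K0 :=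
  isPolishModule_pi (R := R) A.obj

theorem isPolishModule_K1 [∀ n, Countable (A.obj n)] : IsPolishModule R A.K1 :=
  isPolishModule_pi (R := R) (fun l : {l : ℕ × ℕ // l.1 ≤ l.2} => A.obj l.1.1)

theorem continuous_eval_K0 (n : ℕ) : @Continuous A.K0 (A.obj n) _ ⊥ (fun b => b n) := by
  let _ : ∀ i, TopologicalSpace (A.obj i) := fun _ => ⊥
  exact continuous_apply (A := A.obj) n

theorem continuous_eval_K1 (l : {l : ℕ × ℕ // l.1 ≤ l.2}) :
    @Continuous A.K1 (A.obj l.1.1) _ ⊥ (fun c => c l) := by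
  let _ : ∀ i, TopologicalSpace (A.obj i) := fun _ => ⊥
  exact continuous_apply (A := fun l : {l : ℕ × ℕ // l.1 ≤ l.2} => A.obj l.1.1) l

theorem continuous_d1 : Continuous A.d1 := by
  let _ : ∀ i, TopologicalSpace (A.obj i) := fun _ => ⊥
  have : ∀ i, DiscreteTopology (A.obj i) := fun _ => ⟨rfl⟩
  refine continuous_pi (A := fun l : {l : ℕ × ℕ // l.1 ≤ l.2} => A.obj l.1.1) fun l => ?_
  change Continuous fun b : A.K0 => A.p l.2 (b l.1.2) - b l.1.1
  exact (continuous_of_discreteTopology.comp (A.continuous_eval_K0 _)).sub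
    (A.continuous_eval_K0 _)

theorem isClosed_Z1 : IsClosed (A.Z1 : Set A.K1) := by
  let _ : ∀ i, TopologicalSpace (A.obj i) := fun _ => ⊥
  have : ∀ i, DiscreteTopology (A.obj i) := fun _ => ⟨rfl⟩
  have : (A.Z1 : Set A.K1) = ⋂ l : {l : ℕ × ℕ × ℕ // l.1 ≤ l.2.1 ∧ l.2.1 ≤ l.2.2},
      (fun c : A.K1 => A.d2 c l) ⁻¹' {0} := by
    ext c
    simp only [SetLike.mem_coe, LinearMap.mem_ker, Set.mem_iInter, Set.mem_preimage,
      Set.mem_singleton_iff]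
    exact funext_iff
  rw [this]
  refine isClosed_iInter fun l => (isClosed_discrete _).preimage ?_
  change Continuous fun c : A.K1 => A.p l.2.1 (c ⟨(l.1.2.1, l.1.2.2), l.2.2⟩)
    - c ⟨(l.1.1, l.1.2.2), l.2.1.trans l.2.2⟩ + c ⟨(l.1.1, l.1.2.1), l.2.1⟩
  exact ((continuous_of_discreteTopology.comp
    (A.continuous_eval_K1 ⟨(l.1.2.1, l.1.2.2), l.2.2⟩)).sub
    (A.continuous_eval_K1 ⟨(l.1.1, l.1.2.2), l.2.1.trans l.2.2⟩)).add
    (A.continuous_eval_K1 ⟨(l.1.1, l.1.2.1), l.2.1⟩)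

theorem isPolishModule_Z1 [∀ n, Countable (A.obj n)] : IsPolishModule R A.Z1 := by
  obtain ⟨_, _, _⟩ := A.isPolishModule_K1
  refine ⟨A.isClosed_Z1.polishSpace, inferInstance, ⟨fun r => ?_⟩⟩
  exact (continuous_subtype_val.const_smul r).subtype_mk _

end Polish

/-- The image of a Polish module, with a complete compatible group uniformity, under a continuous
linear map is Polishable. -/
theorem isPolishable_range {M N : Type u} [AddCommGroup M] [Module R M] [UniformSpace M]
    [IsUniformAddGroup M] [CompleteSpace M] [AddCommGroup N] [Module R N] [TopologicalSpace N]
    [T1Space N] (hM : IsPolishModule R M) (f : M →ₗ[R] N) (hf : Continuous f) :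
    IsPolishable (LinearMap.range f) := by
  obtain ⟨_, _, _⟩ := hM
  let K := LinearMap.ker f
  have hK : IsClosed (K : Set M) := isClosed_singleton.preimage hf
  have hQ : IsPolishModule R (M ⧸ K) := by
    have hK' : IsClosed (K.toAddSubgroup : Set M) := hK
    have hG : IsTopologicalAddGroup (M ⧸ K) := inferInstance
    have hS : ContinuousConstSMul R (M ⧸ K) := ⟨fun r => by
      refine continuous_quot_lift _ ?_
      exact continuous_quot_mk.comp (continuous_const_smul r)⟩
    have : PolishSpace (M ⧸ K) := by
      let _ : UniformSpace (M ⧸ K) := IsTopologicalAddGroup.rightUniformSpace (M ⧸ K)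
      have : T3Space (M ⧸ K) := QuotientAddGroup.instT3Space K.toAddSubgroup
      have : SecondCountableTopology (M ⧸ K) :=
        QuotientAddGroup.instSecondCountableTopology (N := K.toAddSubgroup)
      have : CompleteSpace (M ⧸ K) := QuotientAddGroup.completeSpace_right M K.toAddSubgroup
      have : (uniformity (M ⧸ K)).IsCountablyGenerated :=
        Filter.comap.isCountablyGenerated _ _
      infer_instance
    exact ⟨inferInstance, hG, hS⟩
  let e : (M ⧸ K) ≃ₗ[R] LinearMap.range f := f.quotKerEquivRange
  let _ : TopologicalSpace (LinearMap.range f) := TopologicalSpace.induced e.symm inferInstance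
  refine ⟨TopologicalSpace.induced e.symm inferInstance, ?_, ?_⟩
  · obtain ⟨_, _, _⟩ := hQ
    let h : LinearMap.range f ≃ₜ (M ⧸ K) := e.symm.toEquiv.toHomeomorphOfIsInducing ⟨rfl⟩
    refine ⟨h.isClosedEmbedding.polishSpace, topologicalAddGroup_induced e.symm, ⟨fun r => ?_⟩⟩
    rw [continuous_induced_rng]
    have : e.symm ∘ (fun x => r • x) = fun x => r • e.symm x := by
      funext x; simp
    rw [this]
    exact (continuous_induced_dom).const_smul r
  · have h1 : Continuous fun q : M ⧸ K => (e q : N) := by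
      refine continuous_quot_lift _ hf
    have : (LinearMap.range f).subtype = (fun q : M ⧸ K => (e q : N)) ∘ e.symm := by
      funext x; simp
    rw [this]
    exact h1.comp continuous_induced_dom

theorem isPolishable_B1 (A : Tower.{u} R) [∀ n, Countable (A.obj n)] : IsPolishable A.B1 := by
  let _ : ∀ n, UniformSpace (A.obj n) := fun _ => ⊥
  have : ∀ n, DiscreteUniformity (A.obj n) := fun _ => ⟨rfl⟩
  let _ : UniformSpace A.K0 := inferInstanceAs (UniformSpace (∀ n, A.obj n))
  have : IsUniformAddGroup A.K0 := inferInstanceAs (IsUniformAddGroup (∀ n, A.obj n))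
  have : CompleteSpace A.K0 := inferInstanceAs (CompleteSpace (∀ n, A.obj n))
  obtain ⟨_, _, _⟩ := A.isPolishModule_Z1
  exact isPolishable_range A.isPolishModule_K0 A.d1Z (A.continuous_d1.subtype_mk _)

/-- `lim¹ A = H¹(K(A)) = Z¹(K(A)) / B¹(K(A))`, as a module with a Polish cover, for a tower `A` of
countable modules. -/
abbrev lim1 (A : Tower.{u} R) [∀ n, Countable (A.obj n)] : ModuleWithPolishCover.{u} R where
  Cover := A.Z1
  isPolishModule := A.isPolishModule_Z1
  N := A.B1
  isPolishable := A.isPolishable_B1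

/-! #### Morphisms of towers -/

/-- Representatives of morphisms of towers, in the category `pro(Mod(R))`. -/
structure ProHom (A B : Tower.{u} R) where
  idx : ℕ → ℕ
  mono : Monotone idx
  app : ∀ k, A.obj (idx k) →ₗ[R] B.obj k
  comm : ∀ k x, B.p (Nat.le_succ k) (app (k + 1) x) = app k (A.p (mono (Nat.le_succ k)) x)

/-- Two representatives define the same morphism of towers. -/
def ProHom.Equiv {A B : Tower.{u} R} (f g : ProHom A B) : Prop :=
  ∃ m : ℕ → ℕ, Monotone m ∧ ∃ (hf : ∀ k, f.idx k ≤ m k) (hg : ∀ k, g.idx k ≤ m k),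
    ∀ k (x : A.obj (m k)), f.app k (A.p (hf k) x) = g.app k (A.p (hg k) x)

/-- The identity morphism. -/
def ProHom.id (A : Tower.{u} R) : ProHom A A where
  idx k := k
  mono := monotone_id
  app _ := LinearMap.id
  comm _ _ := rfl

/-- Composition of morphisms. -/
def ProHom.comp {A B C : Tower.{u} R} (g : ProHom B C) (f : ProHom A B) : ProHom A C where
  idx k := f.idx (g.idx k)
  mono := f.mono.comp g.mono
  app k := g.app k ∘ₗ f.app (g.idx k)
  comm k x := by
    have key : ∀ {i j : ℕ} (h : i ≤ j) (y : A.obj (f.idx j)),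
        B.p h (f.app j y) = f.app i (A.p (f.mono h) y) := by
      intro i j h
      induction j, h using Nat.le_induction with
      | base => intro y; simp
      | succ j h ih =>
        intro y
        rw [← B.p_comp h (Nat.le_succ j), f.comm, ih, A.p_comp]
    simp only [LinearMap.comp_apply]
    rw [g.comm, key]

/-- Isomorphism of towers, in the category `pro(Mod(R))`. -/
def IsIsomorphic (A B : Tower.{u} R) : Prop :=
  ∃ (f : ProHom A B) (g : ProHom B A),
    (g.comp f).Equiv (ProHom.id A) ∧ (f.comp g).Equiv (ProHom.id B)

/-- The zero tower. -/
def zero (R : Type v) [CommRing R] : Tower.{u} R where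
  obj _ := PUnit
  p _ := 0
  p_self _ _ := rfl
  p_comp _ _ _ := rfl

/-- Monomorphic towers: all the bonding maps `A⁽ⁿ⁺¹⁾ → A⁽ⁿ⁾` are injective. -/
def IsMonomorphic (A : Tower.{u} R) : Prop :=
  ∀ n, Function.Injective (A.p (Nat.le_succ n))

/-- Essentially monomorphic towers: towers isomorphic to a monomorphic tower of countable modules. -/
def IsEssentiallyMonomorphic (A : Tower.{u} R) : Prop :=
  ∃ B : Tower.{u} R, (∀ n, Countable (B.obj n)) ∧ B.IsMonomorphic ∧ A.IsIsomorphic B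

/-- Reduced towers: `lim A = 0`. -/
def IsReduced (A : Tower.{u} R) : Prop := A.lim = ⊥

/-! #### Subtowers -/

/-- The subtower of `A` given by submodules `S n` of `A⁽ⁿ⁾` that are compatible with the bonding
maps. -/
def subtower (A : Tower.{u} R) (S : ∀ n, Submodule R (A.obj n))
    (hS : ∀ {n m : ℕ} (h : n ≤ m), ∀ x ∈ S m, A.p h x ∈ S n) : Tower.{u} R where
  obj n := S n
  p h := (A.p h).restrict (hS h)
  p_self h x := Subtype.ext (A.p_self h x.1)
  p_comp h h' x := Subtype.ext (A.p_comp h h' x.1)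

instance (A : Tower.{u} R) [hA : ∀ n, Countable (A.obj n)] (S : ∀ n, Submodule R (A.obj n))
    (hS : ∀ {n m : ℕ} (h : n ≤ m), ∀ x ∈ S m, A.p h x ∈ S n) (n : ℕ) :
    Countable ((A.subtower S hS).obj n) :=
  inferInstanceAs (Countable (S n))

section Inclusion

variable (A : Tower.{u} R) (S : ∀ n, Submodule R (A.obj n))
  (hS : ∀ {n m : ℕ} (h : n ≤ m), ∀ x ∈ S m, A.p h x ∈ S n)

/-- The map `K⁰` of the inclusion of a subtower. -/
def inclK0 : (A.subtower S hS).K0 →ₗ[R] A.K0 where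
  toFun b n := (S n).subtype (b n)
  map_add' _ _ := rfl
  map_smul' _ _ := rfl

/-- The map `K¹` of the inclusion of a subtower. -/
def inclK1 : (A.subtower S hS).K1 →ₗ[R] A.K1 where
  toFun c l := (S l.1.1).subtype (c l)
  map_add' _ _ := rfl
  map_smul' _ _ := rfl

theorem inclK1_mem_Z1 (c : (A.subtower S hS).K1) (hc : c ∈ (A.subtower S hS).Z1) :
    A.inclK1 S hS c ∈ A.Z1 := by
  rw [LinearMap.mem_ker] at hc ⊢
  funext l
  exact congrArg (S l.1.1).subtype (congrFun hc l)

/-- The map `Z¹` of the inclusion of a subtower. -/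
def inclZ1 : (A.subtower S hS).Z1 →ₗ[R] A.Z1 :=
  (A.inclK1 S hS).restrict (A.inclK1_mem_Z1 S hS)

theorem B1_le_comap_inclZ1 : (A.subtower S hS).B1 ≤ A.B1.comap (A.inclZ1 S hS) := by
  rintro _ ⟨b, rfl⟩
  exact ⟨A.inclK0 S hS b, rfl⟩

/-- The homomorphism `lim¹ S → lim¹ A` induced by the inclusion of a subtower `S` of `A`. -/
def inclLim1 [∀ n, Countable (A.obj n)] : (A.subtower S hS).lim1.Quot →ₗ[R] A.lim1.Quot :=
  Submodule.mapQ _ _ (A.inclZ1 S hS) (A.B1_le_comap_inclZ1 S hS)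

end Inclusion

/-! #### Derived towers -/

/-- A choice, for every countable limit ordinal `λ`, of a strictly increasing sequence `(λₙ)` of
successor ordinals with supremum `λ`. -/
structure Ladder where
  seq : Ordinal.{0} → ℕ → Ordinal.{0}
  strictMono : ∀ o, Order.IsSuccLimit o → o < ω₁ → StrictMono (seq o)
  isSucc : ∀ o, Order.IsSuccLimit o → o < ω₁ → ∀ n, ∃ β, seq o n = β + 1
  lt : ∀ o, Order.IsSuccLimit o → o < ω₁ → ∀ n, seq o n < o
  exists_lt : ∀ o, Order.IsSuccLimit o → o < ω₁ → ∀ β < o, ∃ n, β < seq o n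

instance : Nonempty Ladder := by
  have key : ∀ o : Ordinal.{0}, ∃ s : ℕ → Ordinal.{0}, Order.IsSuccLimit o → o < ω₁ →
      StrictMono s ∧ (∀ n, ∃ β, s n = β + 1) ∧ (∀ n, s n < o) ∧ ∀ β < o, ∃ n, β < s n := by
    intro o
    by_cases h : Order.IsSuccLimit o ∧ o < ω₁
    swap
    · exact ⟨fun _ => 0, fun h1 h2 => absurd ⟨h1, h2⟩ h⟩
    obtain ⟨ho, hω⟩ := h
    have hc : (Set.Iio o).Countable := by
      have hcard : o.card ≤ Cardinal.aleph0.{0} := by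
        rw [← Order.lt_succ_iff, ← Cardinal.aleph_zero, Cardinal.succ_aleph, ← Cardinal.lt_ord,
          Cardinal.ord_aleph]
        simpa using hω
      rw [← Cardinal.le_aleph0_iff_set_countable, Cardinal.mk_Iio_ordinal,
        ← Cardinal.lift_aleph0.{1, 0}, Cardinal.lift_le]
      exact hcard
    have hne : (Set.Iio o).Nonempty := ⟨0, ho.bot_lt⟩
    obtain ⟨f, hf⟩ := hc.exists_eq_range hne
    have hfo : ∀ n, f n < o := fun n => by
      have : f n ∈ Set.Iio o := hf ▸ Set.mem_range_self n
      exact this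
    let s : ℕ → Ordinal.{0} := fun n => Nat.rec (f 0 + 1) (fun n t => max t (f (n + 1)) + 1) n
    have hs : ∀ n, s (n + 1) = max (s n) (f (n + 1)) + 1 := fun _ => rfl
    refine ⟨s, fun _ _ => ⟨strictMono_nat_of_lt_succ fun n => ?_, fun n => ?_, fun n => ?_,
      fun β hβ => ?_⟩⟩
    · rw [hs]
      exact (le_max_left _ _).trans_lt (lt_add_one _)
    · cases n with
      | zero => exact ⟨f 0, rfl⟩
      | succ n => exact ⟨_, hs n⟩
    · induction n with
      | zero => exact ho.succ_lt (hfo 0)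
      | succ n ih => exact ho.succ_lt (max_lt ih (hfo _))
    · have : β ∈ Set.range f := hf ▸ hβ
      obtain ⟨n, rfl⟩ := this
      refine ⟨n, ?_⟩
      cases n with
      | zero => exact lt_add_one _
      | succ n =>
        rw [hs]
        exact (le_max_right _ _).trans_lt (lt_add_one _)
  choose s hs using key
  exact ⟨⟨s, fun o h h' => (hs o h h').1, fun o h h' => (hs o h h').2.1,
    fun o h h' => (hs o h h').2.2.1, fun o h h' => (hs o h h').2.2.2⟩⟩

/-- The `n`-th submodule of the `α`-th derived tower: for `α = 0` this is `A⁽ⁿ⁾`, for `α = β + 1`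
it is the intersection of the images in `A⁽ⁿ⁾` of the modules `A_β⁽ⁿ⁺ᵏ⁾`, and for `α` limit it is
the `n`-th submodule of the `αₙ`-th derived tower. (Only the case `α < ω₁` matters.) -/
def derivedSub (A : Tower.{u} R) (L : Ladder) (α : Ordinal.{0}) :
    ∀ n, Submodule R (A.obj n) :=
  Ordinal.limitRecOn α (fun _ => ⊤)
    (fun _ D n => ⨅ k : ℕ, (D (n + k)).map (A.p (Nat.le_add_right n k)))
    (fun o ho D n => open Classical in
      if h : o < ω₁ then D (L.seq o n) (L.lt o ho h n) n else ⊥)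

section Derived

variable (A : Tower.{u} R) (L : Ladder)

theorem derivedSub_zero (n : ℕ) : A.derivedSub L 0 n = ⊤ := by
  simp [derivedSub]

theorem derivedSub_add_one (β : Ordinal.{0}) (n : ℕ) :
    A.derivedSub L (β + 1) n =
      ⨅ k : ℕ, (A.derivedSub L β (n + k)).map (A.p (Nat.le_add_right n k)) := by
  simp [derivedSub]

theorem derivedSub_limit {o : Ordinal.{0}} (ho : Order.IsSuccLimit o) (h : o < ω₁) (n : ℕ) :
    A.derivedSub L o n = A.derivedSub L (L.seq o n) n := by
  simp [derivedSub, ho, h]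

theorem derivedSub_limit' {o : Ordinal.{0}} (ho : Order.IsSuccLimit o) (h : ¬ o < ω₁) (n : ℕ) :
    A.derivedSub L o n = ⊥ := by
  simp [derivedSub, ho, h]

theorem not_isSuccLimit_seq {o : Ordinal.{0}} (ho : Order.IsSuccLimit o) (h : o < ω₁) (n : ℕ) :
    ¬ Order.IsSuccLimit (L.seq o n) := by
  obtain ⟨β, hβ⟩ := L.isSucc o ho h n
  rw [hβ, ← Order.succ_eq_add_one]
  exact Order.not_isSuccLimit_succ β

theorem derivedSub_aux (α : Ordinal.{0}) :
    (∀ {n m : ℕ} (h : n ≤ m), ∀ x ∈ A.derivedSub L α m, A.p h x ∈ A.derivedSub L α n) ∧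
    (α < ω₁ → ¬ Order.IsSuccLimit α → ∀ γ ≤ α, ¬ Order.IsSuccLimit γ → ∀ n,
      A.derivedSub L α n ≤ A.derivedSub L γ n) := by
  induction α using WellFoundedLT.induction with
  | ind α ih =>
  rcases Ordinal.zero_or_succ_or_isSuccLimit α with rfl | ⟨β, rfl⟩ | hα
  · refine ⟨fun h x _ => by simp [derivedSub_zero], fun _ _ γ hγ _ n => ?_⟩
    rw [nonpos_iff_eq_zero.1 hγ]
  · rw [Order.succ_eq_add_one]
    have hβ := ih β (Order.lt_succ β)
    refine ⟨fun {n m} h x hx => ?_, fun hω _ γ hγ hγl n => ?_⟩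
    · rw [derivedSub_add_one, Submodule.mem_iInf] at hx ⊢
      intro k
      obtain ⟨y, hy, rfl⟩ := hx k
      refine ⟨A.p (Nat.add_le_add_right h k) y, hβ.1 _ y hy, ?_⟩
      rw [A.p_comp, A.p_comp]
    · rcases hγ.eq_or_lt with rfl | hγ
      · exact le_rfl
      have hγ' : γ ≤ β := Order.lt_succ_iff.1 hγ
      have hβω : β < ω₁ := (Order.lt_succ β).trans hω
      rw [derivedSub_add_one]
      by_cases hβl : Order.IsSuccLimit β
      · have hlt : γ < β := lt_of_le_of_ne hγ' (fun e => hγl (e ▸ hβl))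
        obtain ⟨k, hk⟩ := L.exists_lt β hβl hβω γ hlt
        refine (iInf_le _ k).trans ?_
        rintro _ ⟨y, hy, rfl⟩
        have hy' : y ∈ A.derivedSub L (L.seq β (n + k)) (n + k) := by
          rw [← derivedSub_limit A L hβl hβω]; exact hy
        have hi := ih (L.seq β (n + k)) ((L.lt β hβl hβω _).trans (Order.lt_succ β))
        exact hi.2 ((L.lt β hβl hβω _).trans hβω) (not_isSuccLimit_seq L hβl hβω _) γ
          (hk.le.trans ((L.strictMono β hβl hβω).monotone (Nat.le_add_left k n))) hγl n
          (hi.1 _ y hy')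
      · refine le_trans ?_ (hβ.2 hβω hβl γ hγ' hγl n)
        refine (iInf_le _ 0).trans ?_
        rintro _ ⟨y, hy, rfl⟩
        exact hβ.1 _ y hy
  · refine ⟨fun {n m} h x hx => ?_, fun _ hl => absurd hα hl⟩
    by_cases hω : α < ω₁
    · rw [derivedSub_limit A L hα hω] at hx ⊢
      have hi := ih (L.seq α m) (L.lt α hα hω m)
      exact hi.1 h x hx |> hi.2 ((L.lt α hα hω m).trans hω) (not_isSuccLimit_seq L hα hω m)
        (L.seq α n) ((L.strictMono α hα hω).monotone h) (not_isSuccLimit_seq L hα hω n) n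
    · rw [derivedSub_limit' A L hα hω, Submodule.mem_bot] at hx ⊢
      rw [hx, map_zero]

/-- At the successor of a limit ordinal `o`, one can use the index `oₖ` in place of `oₙ₊ₖ`. -/
theorem derivedSub_limit_add_one {o : Ordinal.{0}} (ho : Order.IsSuccLimit o) (h : o < ω₁)
    (n : ℕ) : A.derivedSub L (o + 1) n =
      ⨅ k : ℕ, (A.derivedSub L (L.seq o k) (n + k)).map (A.p (Nat.le_add_right n k)) := by
  have anti : ∀ {i j : ℕ}, i ≤ j → ∀ m, A.derivedSub L (L.seq o j) m ≤
      A.derivedSub L (L.seq o i) m := fun {i j} hij m =>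
    (A.derivedSub_aux L _).2 ((L.lt o ho h j).trans h) (not_isSuccLimit_seq L ho h j) _
      ((L.strictMono o ho h).monotone hij) (not_isSuccLimit_seq L ho h i) m
  rw [derivedSub_add_one]
  simp only [derivedSub_limit A L ho h]
  refine le_antisymm (iInf_mono fun k => Submodule.map_mono (anti (Nat.le_add_left k n) _))
    (le_iInf fun k => (iInf_le _ (n + k)).trans ?_)
  rintro _ ⟨y, hy, rfl⟩
  have hk : n + k ≤ n + (n + k) := Nat.le_add_left _ _
  exact ⟨A.p hk y, (A.derivedSub_aux L _).1 hk y hy, by rw [A.p_comp]⟩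

/-- The `α`-th derived tower `A_α` of `A`. -/
def derived (α : Ordinal.{0}) : Tower.{u} R :=
  A.subtower (A.derivedSub L α) (A.derivedSub_aux L α).1

instance [∀ n, Countable (A.obj n)] (α : Ordinal.{0}) (n : ℕ) :
    Countable ((A.derived L α).obj n) :=
  inferInstanceAs (Countable (A.derivedSub L α n))

/-- The homomorphism `lim¹ A_α → lim¹ A` induced by the inclusion `A_α → A`. -/
def derivedInclLim1 [∀ n, Countable (A.obj n)] (α : Ordinal.{0}) :
    (A.derived L α).lim1.Quot →ₗ[R] A.lim1.Quot :=
  A.inclLim1 (A.derivedSub L α) (A.derivedSub_aux L α).1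

/-- `A` has (Mittag-Leffler) length at most `α`: `A_α ≅ 0`. -/
def LengthLE (α : Ordinal.{0}) : Prop :=
  (A.derived L α).IsIsomorphic (zero R)

/-- `A` has plain length at most `α`, where `α` is a successor: `A_{α-1}` is essentially
monomorphic. -/
def PlainLengthLE (α : Ordinal.{0}) : Prop :=
  ∃ β, α = β + 1 ∧ (A.derived L β).IsEssentiallyMonomorphic

end Derived

end Tower

end

/-!
Fix a tower `A` and submodules `D n` of the `A⁽ⁿ⁾` that form a subtower, with derived family
`D' n = ⋂ₘ p(D m)`. Let `H(D) ⊆ Z¹(A)` be the module of the cocycles cohomologous in `A` to one with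
values in `D` (`coboundarySat`), so that `H(D) / B¹` is the image of `lim¹ D`. The key equality
`s_α(lim¹ A) = H(A_α) / B¹` is proved by induction on `α`.

* *Injectivity.* By induction on `α`, `lim (A / A_α) = 0` (`mem_derivedSub_of_coherent`): a cochain
  of `A` whose coboundary lies in `A_α` lies in `A_α`. Hence `lim¹ A_α → lim¹ A` is injective, and a
  diagonal argument gives `H(A_λ) = ⋂_{β < λ} H(A_β)` for limit `λ`
  (`coboundarySat_derivedSub_limit`).

* *A Polish model.* Since `lim (A / D) = 0`, the pairs `(c, ē)` of a cocycle `c` of `A` and a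
  cochain `ē` of `A / D` whose coboundary is the image of `c` form a Polish module that injects
  continuously into `Z¹(A)` with image `H(D)` (`satModel`). Polish module topologies on
  submodules are unique, by Pettis' automatic continuity and the Lusin–Souslin theorem, so
  complexities in `H(D)` can be computed in this model
  (`isSigma02In_iff_preimage`, `isPi03In_iff_preimage`).

* *Successor step, upper bound.* A cocycle `c` of `D` is cohomologous to one of `D'` if and only if
  for every `n` there is `z ∈ D n` with `c_{nm} - z ∈ p(D m)` for all `m ≥ n`. For fixed `n` and `z`
  the condition is closed, and there are only countably many `z`, so that `H(D')` is `Π⁰₃` in `H(D)`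
  (`preimage_coboundarySat_eq_iInter`).

* *Successor step, lower bound.* If `K ⊇ B¹` is a `Π⁰₃` submodule of `H(D)`, then the set of the
  `(c, e) ∈ Z¹(D') × K⁰(D)` with `c + d e ∈ K` is comeagre: the Baire category theorem is applied in
  `K⁰(D)` to produce sets of coboundaries inside one of the closed sets that make up `K`, and the
  closures of these sets are neighbourhoods with respect to `Z¹(D')`, because coefficients in `D'`
  lift to all the `D m`. Hence `Z¹(D') ⊆ K` (`cocyclesIn_le_of_isPi03`).

For a reduced tower `d` is injective, so by automatic continuity it has a continuous inverse on any
closed submodule of `Z¹` that consists of coboundaries. Tested on finitely supported cochains `p y`,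
this says that certain bonding maps vanish (`IsReduced.exists_p_eq_zero`). Applied to all of
`Z¹(A_α)`, it shows that `lim¹ A_α = 0` implies `A_α ≅ 0`. If `B¹` is `Σ⁰₂` in `H(A_β)`, the Baire
category theorem yields an `n₀` such that all the cocycles of `A_β` with coefficients vanishing at
the indices up to `n₀` are coboundaries; the same test then shows that, for every `n` and all large
`m`, the kernel of `A_β⁽ᵐ⁾ → A⁽ⁿ⁰⁾` is contained in that of `A_β⁽ᵐ⁾ → A⁽ⁿ⁾`, which characterizes
essentially monomorphic towers. Conversely, this condition lets one `n₀` suffice in the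
description of coboundaries by closed conditions, so that `B¹` is `Σ⁰₂` (`preimage_B1_eq_iUnion`).
-/

noncomputable section

/-! ### Automatic continuity and uniqueness of Polish module topologies -/

open Filter in
/-- Automatic continuity, by the argument of Pettis: if countably many translates of `W` cover `H`,
then the Borel preimage of one of them is not meagre, so that its difference set is a
neighbourhood of `0`. -/
theorem AddMonoidHom.continuous_of_borel_measurable {G H : Type*} [AddCommGroup G]
    [TopologicalSpace G] [IsTopologicalAddGroup G] [BaireSpace G] [MeasurableSpace G] [BorelSpace G]
    [AddCommGroup H] [TopologicalSpace H] [IsTopologicalAddGroup H]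
    [TopologicalSpace.SeparableSpace H] [MeasurableSpace H] [BorelSpace H]
    (f : G →+ H) (hf : Measurable f) : Continuous f := by
  refine continuous_of_continuousAt_zero f ?_
  rw [ContinuousAt, map_zero]
  intro V hV
  obtain ⟨W, hWo, h0W, hW⟩ : ∃ W : Set H, IsOpen W ∧ (0 : H) ∈ W ∧
      ∀ x ∈ W, ∀ y ∈ W, x - y ∈ V := by
    have h : Tendsto (fun p : H × H => p.1 - p.2) (𝓝 (0, 0)) (𝓝 0) := by
      have h1 : Continuous fun p : H × H => p.1 - p.2 := continuous_fst.sub continuous_snd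
      simpa using h1.tendsto ((0 : H), (0 : H))
    have h2 := h hV
    rw [mem_map, nhds_prod_eq, mem_prod_same_iff] at h2
    obtain ⟨t, ht, hts⟩ := h2
    obtain ⟨W, hWt, hWo, h0⟩ := mem_nhds_iff.1 ht
    exact ⟨W, hWo, h0, fun x hx y hy => @hts (x, y) ⟨hWt hx, hWt hy⟩⟩
  let h := TopologicalSpace.denseSeq H
  let A : ℕ → Set G := fun i => f ⁻¹' {z | z - h i ∈ W}
  have hAm : ∀ i, MeasurableSet (A i) := fun i =>
    hf (hWo.preimage (continuous_id.sub continuous_const)).measurableSet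
  have hcov : (⋃ i, A i) = Set.univ := by
    refine Set.eq_univ_of_forall fun g => Set.mem_iUnion.2 ?_
    obtain ⟨i, hi⟩ := (TopologicalSpace.denseRange_denseSeq H).exists_mem_open
      (hWo.preimage (continuous_const.sub continuous_id : Continuous fun z => f g - z))
      ⟨f g, by simpa using h0W⟩
    exact ⟨i, hi⟩
  obtain ⟨i, hi⟩ : ∃ i, ¬ IsMeagre (A i) := by
    by_contra! hne
    have : IsMeagre (⋃ i, A i) := isMeagre_iUnion hne
    rw [hcov] at this
    exact not_isMeagre_of_isOpen isOpen_univ ⟨0, trivial⟩ this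
  obtain ⟨U, hUo, hAU⟩ := (hAm i).residualEq_isOpen
  obtain ⟨u, hu⟩ : U.Nonempty := by
    by_contra hU
    rw [Set.not_nonempty_iff_eq_empty] at hU
    subst hU
    refine hi (mem_of_superset (eventuallyEq_set.1 hAU) fun x hx => ?_)
    exact fun hxA => (hx.1 hxA)
  have hN : {g : G | u + g ∈ U} ∈ 𝓝 (0 : G) :=
    (hUo.preimage (continuous_const.add continuous_id)).mem_nhds (by simpa using hu)
  rw [mem_map]
  refine mem_of_superset hN fun g hg => ?_
  have htr : Tendsto (fun x : G => x + g) (residual G) (residual G) :=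
    tendsto_residual_of_isOpenMap (Homeomorph.addRight g).continuous
      (Homeomorph.addRight g).isOpenMap
  obtain ⟨a, ha, ha'⟩ : ∃ a, a ∈ A i ∧ a + g ∈ A i := by
    by_contra! hne
    refine not_isMeagre_of_isOpen (hUo.inter (hUo.preimage (continuous_id.add
      (continuous_const (y := g))))) ⟨u, hu, hg⟩ ?_
    have e1 := eventuallyEq_set.1 hAU
    filter_upwards [e1, htr.eventually e1] with x hx hx' hxU
    exact hne x (hx.2 hxU.1) (hx'.2 hxU.2)
  have : f g = (f (a + g) - h i) - (f a - h i) := by rw [map_add]; abel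
  rw [Set.mem_preimage, this]
  exact hW _ ha' _ ha

/-- A closed graph theorem for Polish groups. By the Lusin–Souslin theorem, the continuous
injection `j` is a Borel embedding, and so `f` is Borel. -/
theorem AddMonoidHom.continuous_of_comp_injective {G H Z : Type*} [AddCommGroup G]
    [TopologicalSpace G] [IsTopologicalAddGroup G] [PolishSpace G] [AddCommGroup H]
    [TopologicalSpace H] [IsTopologicalAddGroup H] [PolishSpace H] [TopologicalSpace Z] [T2Space Z]
    {j : H → Z} (hj : Continuous j) (hji : Function.Injective j) (f : G →+ H)
    (hf : Continuous (j ∘ f)) : Continuous f := by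
  borelize G H Z
  refine f.continuous_of_borel_measurable ?_
  exact (hj.measurableEmbedding hji).measurable_comp_iff.1 hf.measurable

section Descriptive

variable {X Y : Type*} [TopologicalSpace X] [TopologicalSpace Y]

theorem IsSigma02.preimage {s : Set Y} (hs : IsSigma02 s) {f : X → Y} (hf : Continuous f) :
    IsSigma02 (f ⁻¹' s) := by
  obtain ⟨F, hF, rfl⟩ := hs
  exact ⟨fun n => f ⁻¹' F n, fun n => (hF n).preimage hf, Set.preimage_iUnion⟩

theorem IsPi03.preimage {s : Set Y} (hs : IsPi03 s) {f : X → Y} (hf : Continuous f) :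
    IsPi03 (f ⁻¹' s) := by
  obtain ⟨S, hS, rfl⟩ := hs
  exact ⟨fun n => f ⁻¹' S n, fun n => (hS n).preimage hf, Set.preimage_iInter⟩

theorem IsSigma02.isPi03 {s : Set X} (hs : IsSigma02 s) : IsPi03 s :=
  ⟨fun _ => s, fun _ => hs, (Set.iInter_const s).symm⟩

theorem isSigma02_iUnion_of_isClosed {ι : Type*} [Countable ι] {F : ι → Set X}
    (hF : ∀ i, IsClosed (F i)) : IsSigma02 (⋃ i, F i) := by
  rcases isEmpty_or_nonempty ι with hι | hι
  · exact ⟨fun _ => ∅, fun _ => isClosed_empty, by simp⟩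
  · obtain ⟨e, he⟩ := exists_surjective_nat ι
    exact ⟨fun n => F (e n), fun n => hF _, (he.iUnion_comp F).symm⟩

end Descriptive

section Polishable

variable {R : Type v} {M W : Type u} [CommRing R] [AddCommGroup M] [Module R M]
  [TopologicalSpace M] [AddCommGroup W] [Module R W] [TopologicalSpace W]

theorem IsPolishModule.submodule (hW : IsPolishModule R W) (S : Submodule R W)
    (hS : IsClosed (S : Set W)) : IsPolishModule R S := by
  obtain ⟨_, _, _⟩ := hW
  exact ⟨hS.polishSpace, inferInstance,
    ⟨fun r => (continuous_subtype_val.const_smul r).subtype_mk _⟩⟩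

theorem IsPolishModule.prod (hW : IsPolishModule R W) (hM : IsPolishModule R M) :
    IsPolishModule R (W × M) := by
  obtain ⟨_, _, _⟩ := hW
  obtain ⟨_, _, _⟩ := hM
  exact ⟨inferInstance, inferInstance, inferInstance⟩

theorem IsPolishTopologyOn.unique [T2Space M] {H : Submodule R M} {τ σ : TopologicalSpace H}
    (hτ : IsPolishTopologyOn H τ) (hσ : IsPolishTopologyOn H σ) : τ = σ := by
  have key : ∀ {τ σ : TopologicalSpace H}, IsPolishTopologyOn H τ → IsPolishTopologyOn H σ →
      τ ≤ σ := by
    rintro τ σ ⟨⟨hτp, hτg, -⟩, hτc⟩ ⟨⟨hσp, hσg, -⟩, hσc⟩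
    have := @AddMonoidHom.continuous_of_comp_injective H H M _ τ hτg hτp _ σ hσg hσp _ _
      H.subtype hσc H.injective_subtype (AddMonoidHom.id H) hτc
    exact continuous_id_iff_le.1 this
  exact le_antisymm (key hτ hσ) (key hσ hτ)

/-- The topology transported along an injective continuous linear map `g` from a Polish module is
a Polish module topology on the range of `g`. -/
theorem IsPolishModule.isPolishTopologyOn_range (hW : IsPolishModule R W) (g : W →ₗ[R] M)
    (hg : Continuous g) (hi : Function.Injective g) :
    IsPolishTopologyOn (LinearMap.range g)
      (TopologicalSpace.induced (LinearEquiv.ofInjective g hi).symm inferInstance) := by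
  obtain ⟨_, _, _⟩ := hW
  let e := LinearEquiv.ofInjective g hi
  let _ : TopologicalSpace (LinearMap.range g) := TopologicalSpace.induced e.symm inferInstance
  let h : LinearMap.range g ≃ₜ W := e.symm.toEquiv.toHomeomorphOfIsInducing ⟨rfl⟩
  refine ⟨⟨h.isClosedEmbedding.polishSpace, topologicalAddGroup_induced e.symm, ⟨fun r => ?_⟩⟩, ?_⟩
  · rw [continuous_induced_rng]
    have : e.symm ∘ (fun x => r • x) = fun x => r • e.symm x := by
      funext x; simp
    rw [this]
    exact continuous_induced_dom.const_smul r
  · have : (LinearMap.range g).subtype = g ∘ e.symm := by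
      funext x
      exact (congrArg Subtype.val (e.apply_symm_apply x)).symm
    rw [this]
    exact hg.comp continuous_induced_dom

theorem IsPolishModule.exists_isPolishTopologyOn (hW : IsPolishModule R W) {H : Submodule R M}
    {g : W →ₗ[R] M} (hg : Continuous g) (hi : Function.Injective g)
    (hH : LinearMap.range g = H) : ∃ τ : TopologicalSpace H, IsPolishTopologyOn H τ ∧
      ∃ h : H ≃ₜ W, ∀ x, g (h x) = x := by
  subst hH
  let _ : TopologicalSpace (LinearMap.range g) :=
    TopologicalSpace.induced (LinearEquiv.ofInjective g hi).symm inferInstance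
  exact ⟨_, hW.isPolishTopologyOn_range g hg hi,
    (LinearEquiv.ofInjective g hi).symm.toEquiv.toHomeomorphOfIsInducing ⟨rfl⟩,
    fun x => congrArg Subtype.val ((LinearEquiv.ofInjective g hi).apply_symm_apply x)⟩

/-- The complexity of `K` in the Polishable submodule `H` can be computed in any Polish module that
injects continuously with image `H`. -/
theorem isSigma02In_iff_preimage [T2Space M] (hW : IsPolishModule R W) {H : Submodule R M}
    {g : W →ₗ[R] M} (hg : Continuous g) (hi : Function.Injective g)
    (hH : LinearMap.range g = H) {K : Submodule R M} :
    IsSigma02In K H ↔ IsSigma02 (g ⁻¹' K) := by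
  obtain ⟨τ, hτ, h, hh⟩ := hW.exists_isPolishTopologyOn hg hi hH
  have e : {x : H | (x : M) ∈ K} = h ⁻¹' (g ⁻¹' K) := by ext x; simp [hh]
  have e' : g ⁻¹' K = h.symm ⁻¹' {x : H | (x : M) ∈ K} := by
    rw [e, ← Set.preimage_comp, h.self_comp_symm, Set.preimage_id]
  constructor
  · rintro ⟨σ, hσ, hK⟩
    obtain rfl := hσ.unique hτ
    exact e' ▸ hK.preimage h.symm.continuous
  · exact fun hK => ⟨τ, hτ, e ▸ hK.preimage h.continuous⟩

/-- The analogue of `isSigma02In_iff_preimage` for `Π⁰₃`. -/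
theorem isPi03In_iff_preimage [T2Space M] (hW : IsPolishModule R W) {H : Submodule R M}
    {g : W →ₗ[R] M} (hg : Continuous g) (hi : Function.Injective g)
    (hH : LinearMap.range g = H) {K : Submodule R M} :
    IsPi03In K H ↔ IsPi03 (g ⁻¹' K) := by
  obtain ⟨τ, hτ, h, hh⟩ := hW.exists_isPolishTopologyOn hg hi hH
  have e : {x : H | (x : M) ∈ K} = h ⁻¹' (g ⁻¹' K) := by ext x; simp [hh]
  have e' : g ⁻¹' K = h.symm ⁻¹' {x : H | (x : M) ∈ K} := by
    rw [e, ← Set.preimage_comp, h.self_comp_symm, Set.preimage_id]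
  constructor
  · rintro ⟨σ, hσ, hK⟩
    obtain rfl := hσ.unique hτ
    exact e' ▸ hK.preimage h.symm.continuous
  · exact fun hK => ⟨τ, hτ, e ▸ hK.preimage h.continuous⟩

end Polishable

namespace Tower

variable {R : Type v} [CommRing R] (A : Tower.{u} R)

/-! ### Cochains and cocycles with values in a family of submodules -/

/-- The coefficient `c_{nm} ∈ A⁽ⁿ⁾` of a cocycle `c`. -/
def coef {n m : ℕ} (h : n ≤ m) : A.Z1 →ₗ[R] A.obj n where
  toFun c := c.1 ⟨(n, m), h⟩
  map_add' _ _ := rfl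
  map_smul' _ _ := rfl

variable {A}

theorem Z1_ext {c c' : A.Z1} (h : ∀ {n m : ℕ} (h : n ≤ m), A.coef h c = A.coef h c') : c = c' :=
  Subtype.ext (funext fun l => h l.2)

theorem coef_trans {n m k : ℕ} (h : n ≤ m) (h' : m ≤ k) (c : A.Z1) :
    A.coef (h.trans h') c = A.coef h c + A.p h (A.coef h' c) := by
  have h1 : A.d2 c.1 = 0 := LinearMap.mem_ker.1 c.2
  have h2 : A.p h (A.coef h' c) - A.coef (h.trans h') c + A.coef h c = 0 :=
    congrFun h1 ⟨(n, m, k), h, h'⟩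
  rw [← sub_eq_zero, ← neg_eq_zero, ← h2]
  abel

theorem coef_self {n : ℕ} (h : n ≤ n) (c : A.Z1) : A.coef h c = 0 := by
  have := coef_trans h h c
  rwa [A.p_self, left_eq_add] at this

theorem coef_d1Z {n m : ℕ} (h : n ≤ m) (e : A.K0) :
    A.coef h (A.d1Z e) = A.p h (e m) - e n := rfl

theorem K0_sub_apply (e f : A.K0) (n : ℕ) : (e - f) n = e n - f n := rfl

theorem d1Z_mem_B1 (e : A.K0) : A.d1Z e ∈ A.B1 := LinearMap.mem_range_self _ e

/-- The `0`-cochain `e`, supported on the indices `l ≤ m`, for which `d e` agrees with `c` up to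
the index `m`, normalised by `eₘ = y`. -/
def primitive (c : A.Z1) (m : ℕ) (y : A.obj m) : A.K0 := fun l =>
  if h : l ≤ m then A.p h y - A.coef h c else 0

theorem primitive_apply (c : A.Z1) {m l : ℕ} (y : A.obj m) (h : l ≤ m) :
    primitive c m y l = A.p h y - A.coef h c := dif_pos h

theorem primitive_apply_of_lt (c : A.Z1) {m l : ℕ} (y : A.obj m) (h : m < l) :
    primitive c m y l = 0 := dif_neg h.not_ge

theorem coef_d1Z_primitive (c : A.Z1) {i l m : ℕ} (y : A.obj m) (h : i ≤ l) (hl : l ≤ m) :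
    A.coef h (A.d1Z (primitive c m y)) = A.coef h c := by
  rw [coef_d1Z, primitive_apply c y hl, primitive_apply c y (h.trans hl), coef_trans h hl, map_sub,
    A.p_comp]
  abel

variable (A)

/-- The `0`-cochains of `A` with values in the submodules `D n`. -/
def cochainsIn (D : ∀ n, Submodule R (A.obj n)) : Submodule R A.K0 where
  carrier := {e | ∀ n, e n ∈ D n}
  add_mem' ha hb n := (D n).add_mem (ha n) (hb n)
  zero_mem' n := (D n).zero_mem
  smul_mem' r _ ha n := (D n).smul_mem r (ha n)

/-- The `1`-cocycles of `A` with values in the submodules `D n`. -/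
def cocyclesIn (D : ∀ n, Submodule R (A.obj n)) : Submodule R A.Z1 :=
  ⨅ l : {l : ℕ × ℕ // l.1 ≤ l.2}, (D l.1.1).comap (A.coef l.2)

/-- The cocycles cohomologous in `A` to a cocycle with values in the submodules `D n`. If the `D n`
form a subtower, the quotient of this module by `B¹` is the image of `lim¹ D` in `lim¹ A`. -/
def coboundarySat (D : ∀ n, Submodule R (A.obj n)) : Submodule R A.Z1 := A.cocyclesIn D ⊔ A.B1

variable {A} {D D' : ∀ n, Submodule R (A.obj n)}

theorem mem_cochainsIn {e : A.K0} : e ∈ A.cochainsIn D ↔ ∀ n, e n ∈ D n := Iff.rfl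

theorem mem_cocyclesIn {c : A.Z1} :
    c ∈ A.cocyclesIn D ↔ ∀ {n m : ℕ} (h : n ≤ m), A.coef h c ∈ D n := by
  simp only [cocyclesIn, Submodule.mem_iInf, Submodule.mem_comap]
  exact ⟨fun h n m hnm => h ⟨(n, m), hnm⟩, fun h l => h l.2⟩

theorem mem_coboundarySat {c : A.Z1} :
    c ∈ A.coboundarySat D ↔ ∃ c' ∈ A.cocyclesIn D, ∃ e : A.K0, c' + A.d1Z e = c := by
  simp only [coboundarySat, Submodule.mem_sup, LinearMap.mem_range]
  constructor
  · rintro ⟨c', hc', _, ⟨e, rfl⟩, h⟩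
    exact ⟨c', hc', e, h⟩
  · rintro ⟨c', hc', e, h⟩
    exact ⟨c', hc', _, ⟨e, rfl⟩, h⟩

theorem B1_le_coboundarySat : A.B1 ≤ A.coboundarySat D := le_sup_right

theorem cocyclesIn_mono (h : ∀ n, D n ≤ D' n) : A.cocyclesIn D ≤ A.cocyclesIn D' :=
  fun _ hc => mem_cocyclesIn.2 fun hnm => h _ (mem_cocyclesIn.1 hc hnm)

theorem cocyclesIn_top : A.cocyclesIn (fun _ => ⊤) = ⊤ :=
  eq_top_iff.2 fun _ _ => mem_cocyclesIn.2 fun _ => trivial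

variable (A) in
/-- The submodules `D n` form a subtower of `A`. -/
def IsSubtower (D : ∀ n, Submodule R (A.obj n)) : Prop :=
  ∀ (n m : ℕ) (h : n ≤ m), ∀ x ∈ D m, A.p h x ∈ D n

theorem IsSubtower.d1Z_mem (hD : A.IsSubtower D) {e : A.K0} (he : e ∈ A.cochainsIn D) :
    A.d1Z e ∈ A.cocyclesIn D :=
  mem_cocyclesIn.2 fun h => (D _).sub_mem (hD _ _ h _ (he _)) (he _)

theorem IsSubtower.primitive_mem (hD : A.IsSubtower D) {c : A.Z1} (hc : c ∈ A.cocyclesIn D) {m : ℕ}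
    {y : A.obj m} (hy : y ∈ D m) : primitive c m y ∈ A.cochainsIn D := by
  intro l
  by_cases h : l ≤ m
  · rw [primitive_apply c y h]
    exact (D l).sub_mem (hD _ _ h _ hy) (mem_cocyclesIn.1 hc h)
  · rw [primitive_apply_of_lt c y (not_le.1 h)]
    exact zero_mem _

/-- A cocycle is determined up to coboundaries by its coefficients with large indices: the
cochain `b` is `0` from `n₀` on, and below `n₀` it is `c_{n n₀}`. -/
theorem exists_d1Z_eq_below (n₀ : ℕ) (c : A.Z1) : ∃ b : A.K0,
    (∀ {n m : ℕ} (h : n ≤ m), n₀ ≤ n → A.coef h (c + A.d1Z b) = A.coef h c) ∧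
    ∀ {n m : ℕ} (h : n ≤ m) (hn : n < n₀), A.coef h (c + A.d1Z b) =
      if hm : n₀ ≤ m then A.p hn.le (A.coef hm c) else 0 := by
  refine ⟨-primitive c n₀ 0, fun {n m} h hn => ?_, fun {n m} h hn => ?_⟩
  · have key : ∀ k, n₀ ≤ k → primitive c n₀ 0 k = 0 := by
      intro k hk
      rcases hk.eq_or_lt with rfl | hk
      · rw [primitive_apply c 0 le_rfl, coef_self, map_zero, _root_.sub_zero]
      · exact primitive_apply_of_lt c 0 hk
    rw [map_add, map_neg, map_neg, coef_d1Z, key m (hn.trans h), key n hn, map_zero,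
      _root_.sub_zero, neg_zero, add_zero]
  · rw [map_add, map_neg, map_neg]
    split_ifs with hm
    · rw [coef_d1Z, primitive_apply c 0 hn.le, coef_trans hn.le hm]
      rcases hm.eq_or_lt with rfl | hm'
      · rw [primitive_apply c 0 le_rfl, coef_self]
        simp
      · rw [primitive_apply_of_lt c 0 hm']
        simp only [map_zero]
        abel
    · rw [coef_d1Z_primitive c 0 h (not_le.1 hm).le, add_neg_cancel]

theorem coboundarySat_le_of_eventually_le (hD' : A.IsSubtower D') {n₀ : ℕ}
    (h : ∀ n, n₀ ≤ n → D n ≤ D' n) : A.coboundarySat D ≤ A.coboundarySat D' := by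
  refine sup_le (fun c hc => ?_) le_sup_right
  obtain ⟨b, hb, hb'⟩ := exists_d1Z_eq_below n₀ c
  refine mem_coboundarySat.2 ⟨c + A.d1Z b, mem_cocyclesIn.2 fun {n m} hnm => ?_, -b, ?_⟩
  · rcases le_or_gt n₀ n with hn | hn
    · rw [hb hnm hn]
      exact h n hn (mem_cocyclesIn.1 hc hnm)
    · rw [hb' hnm hn]
      split_ifs with hm
      · exact hD' _ _ _ _ (h n₀ le_rfl (mem_cocyclesIn.1 hc hm))
      · exact zero_mem _
  · rw [map_neg, add_neg_cancel_right]

/-! ### The derived subtowers -/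

variable (A) (L : Ladder)

theorem isSubtower_derivedSub (α : Ordinal.{0}) : A.IsSubtower (A.derivedSub L α) :=
  fun _ _ => (A.derivedSub_aux L α).1

theorem derivedSub_seq_anti {o : Ordinal.{0}} (ho : Order.IsSuccLimit o) (h : o < ω₁) {i j : ℕ}
    (hij : i ≤ j) (n : ℕ) : A.derivedSub L (L.seq o j) n ≤ A.derivedSub L (L.seq o i) n :=
  (A.derivedSub_aux L _).2 ((L.lt o ho h j).trans h) (not_isSuccLimit_seq L ho h j) _
    ((L.strictMono o ho h).monotone hij) (not_isSuccLimit_seq L ho h i) n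

theorem derivedSub_add_one_le (α : Ordinal.{0}) (n : ℕ) :
    A.derivedSub L (α + 1) n ≤ A.derivedSub L α n := by
  rw [derivedSub_add_one]
  refine (iInf_le _ 0).trans ?_
  rintro _ ⟨y, hy, rfl⟩
  exact A.isSubtower_derivedSub L α _ _ _ y hy

theorem mem_derivedSub_add_one {α : Ordinal.{0}} {n : ℕ} {x : A.obj n} :
    x ∈ A.derivedSub L (α + 1) n ↔
      ∀ {m : ℕ} (h : n ≤ m), ∃ y ∈ A.derivedSub L α m, A.p h y = x := by
  rw [derivedSub_add_one, Submodule.mem_iInf]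
  constructor
  · intro hx m h
    obtain ⟨k, rfl⟩ := Nat.exists_eq_add_of_le h
    exact hx k
  · exact fun hx k => hx (Nat.le_add_right n k)

/-- Along the limit stages, the derived subtowers decrease only eventually, since
`A_λ⁽ⁿ⁾ = A_{λₙ}⁽ⁿ⁾`. -/
theorem exists_derivedSub_le {α β : Ordinal.{0}} (hα : α < ω₁) (hβ : β ≤ α) :
    ∃ n₀, ∀ n, n₀ ≤ n → A.derivedSub L α n ≤ A.derivedSub L β n := by
  induction α using WellFoundedLT.induction with
  | ind α ih =>
  rcases hβ.eq_or_lt with rfl | hβ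
  · exact ⟨0, fun n _ => le_rfl⟩
  rcases Ordinal.zero_or_succ_or_isSuccLimit α with rfl | ⟨γ, rfl⟩ | hl
  · exact absurd hβ not_lt_zero
  · obtain ⟨n₀, h⟩ := ih γ (Order.lt_succ γ) ((Order.lt_succ γ).trans hα) (Order.lt_succ_iff.1 hβ)
    exact ⟨n₀, fun n hn => (A.derivedSub_add_one_le L γ n).trans (h n hn)⟩
  · obtain ⟨k, hk⟩ := L.exists_lt α hl hα β hβ
    obtain ⟨n₀, h⟩ := ih _ (L.lt α hl hα k) ((L.lt α hl hα k).trans hα) hk.le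
    refine ⟨max n₀ k, fun n hn => ?_⟩
    rw [derivedSub_limit A L hl hα]
    exact (A.derivedSub_seq_anti L hl hα ((le_max_right _ _).trans hn) n).trans
      (h n ((le_max_left _ _).trans hn))

/-- A family that is coherent modulo `A_α` already lies in `A_α`; in other words
`lim (A / A_α) = 0`. -/
theorem mem_derivedSub_of_coherent {α : Ordinal.{0}} (hα : α < ω₁) {e : A.K0} {n₀ : ℕ}
    (he : ∀ {n m : ℕ} (h : n ≤ m), n₀ ≤ n → A.p h (e m) - e n ∈ A.derivedSub L α n) {n : ℕ}
    (hn : n₀ ≤ n) : e n ∈ A.derivedSub L α n := by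
  induction α using WellFoundedLT.induction generalizing n₀ n with
  | ind α ih =>
  rcases Ordinal.zero_or_succ_or_isSuccLimit α with rfl | ⟨γ, rfl⟩ | hl
  · rw [derivedSub_zero]
    trivial
  · rw [Order.succ_eq_add_one] at he ⊢
    have hγ : ∀ {m}, n₀ ≤ m → e m ∈ A.derivedSub L γ m :=
      ih γ (Order.lt_succ γ) ((Order.lt_succ γ).trans hα)
        (fun h hn => A.derivedSub_add_one_le L γ _ (he h hn))
    refine (A.mem_derivedSub_add_one L).2 fun {m} h => ?_
    obtain ⟨y, hy, hy'⟩ := (A.mem_derivedSub_add_one L).1 (he h hn) h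
    refine ⟨e m - y, Submodule.sub_mem _ (hγ (hn.trans h)) hy, ?_⟩
    rw [map_sub, hy', sub_sub_cancel]
  · rw [derivedSub_limit A L hl hα]
    refine ih _ (L.lt α hl hα n) ((L.lt α hl hα n).trans hα) (n₀ := n) (fun {i m} h hi => ?_) le_rfl
    have := he h (hn.trans hi)
    rw [derivedSub_limit A L hl hα] at this
    exact A.derivedSub_seq_anti L hl hα hi i this

theorem mem_cochainsIn_derivedSub {α : Ordinal.{0}} (hα : α < ω₁) {e : A.K0}
    (he : A.d1Z e ∈ A.cocyclesIn (A.derivedSub L α)) : e ∈ A.cochainsIn (A.derivedSub L α) :=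
  fun _ => A.mem_derivedSub_of_coherent L hα (n₀ := 0) (fun h _ => mem_cocyclesIn.1 he h)
    (Nat.zero_le _)

theorem coboundarySat_derivedSub_anti {α β : Ordinal.{0}} (hα : α < ω₁) (hβ : β ≤ α) :
    A.coboundarySat (A.derivedSub L α) ≤ A.coboundarySat (A.derivedSub L β) := by
  obtain ⟨n₀, h⟩ := A.exists_derivedSub_le L hα hβ
  exact coboundarySat_le_of_eventually_le (A.isSubtower_derivedSub L β) h

/-- If `c - d b⁽ᵏ⁾` has values in `A_{λₖ}` for all `k`, then so does `b⁽ᵏ⁾ - b⁽ʲ⁾` for `j ≥ k`, and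
the diagonal cochain `n ↦ b⁽ⁿ⁾ₙ` moves `c` into `A_λ`. -/
theorem coboundarySat_derivedSub_limit {o : Ordinal.{0}} (ho : Order.IsSuccLimit o) (h : o < ω₁) :
    A.coboundarySat (A.derivedSub L o) =
      ⨅ β : Set.Iio o, A.coboundarySat (A.derivedSub L β.1) := by
  refine le_antisymm (le_iInf fun β => A.coboundarySat_derivedSub_anti L h β.2.le) fun c hc => ?_
  rw [Submodule.mem_iInf] at hc
  have hc' : ∀ k, ∃ b : A.K0, c - A.d1Z b ∈ A.cocyclesIn (A.derivedSub L (L.seq o k)) := by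
    intro k
    obtain ⟨c', hc', e, rfl⟩ := mem_coboundarySat.1 (hc ⟨L.seq o k, L.lt o ho h k⟩)
    exact ⟨e, by simpa using hc'⟩
  choose b hb using hc'
  have hbb : ∀ {i j : ℕ}, i ≤ j → b i - b j ∈ A.cochainsIn (A.derivedSub L (L.seq o i)) := by
    intro i j hij
    refine A.mem_cochainsIn_derivedSub L ((L.lt o ho h i).trans h) ?_
    have h1 := Submodule.sub_mem _
      (cocyclesIn_mono (A.derivedSub_seq_anti L ho h hij) (hb j)) (hb i)
    rwa [sub_sub_sub_cancel_left, ← map_sub] at h1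
  let e : A.K0 := fun n => b n n
  refine mem_coboundarySat.2 ⟨c - A.d1Z e, mem_cocyclesIn.2 fun {n m} hnm => ?_,
    _, sub_add_cancel _ _⟩
  rw [derivedSub_limit A L ho h]
  have h1 := mem_cocyclesIn.1 (hb n) hnm
  have h2 := A.isSubtower_derivedSub L (L.seq o n) _ _ hnm _ (hbb hnm m)
  rw [map_sub, coef_d1Z] at h1 ⊢
  rw [K0_sub_apply, map_sub] at h2
  have h3 : A.coef hnm c - (A.p hnm (e m) - e n) =
      A.coef hnm c - (A.p hnm (b n m) - b n n) + (A.p hnm (b n m) - A.p hnm (b m m)) := by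
    change A.coef hnm c - (A.p hnm (b m m) - b n n) = _
    abel
  rw [h3]
  exact Submodule.add_mem _ h1 h2

end Tower

/-! ### Neighbourhoods in the spaces of cochains -/

theorem hasBasis_nhds_pi_of_discrete {ι : Type*} {M : ι → Type*} [∀ i, TopologicalSpace (M i)]
    [∀ i, DiscreteTopology (M i)] (r : ι → ℕ) (hr : ∀ m, {i | r i ≤ m}.Finite) (x : ∀ i, M i) :
    (𝓝 x).HasBasis (fun _ : ℕ => True) fun m => {y | ∀ i, r i ≤ m → y i = x i} := by
  refine ⟨fun t => ⟨fun ht => ?_, ?_⟩⟩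
  · rw [nhds_pi, Filter.mem_pi] at ht
    obtain ⟨I, hI, s, hs, hst⟩ := ht
    obtain ⟨m, hm⟩ := (hI.image r).bddAbove
    refine ⟨m, trivial, fun y hy => hst fun i hi => ?_⟩
    rw [hy i (hm ⟨i, hi, rfl⟩)]
    exact mem_of_mem_nhds (hs i)
  · rintro ⟨m, -, hm⟩
    refine Filter.mem_of_superset (set_pi_mem_nhds (s := fun i => {x i}) (hr m) fun i _ => ?_)
      fun y hy => hm fun i hi => hy i hi
    exact (isOpen_discrete _).mem_nhds rfl

namespace Tower

variable {R : Type v} [CommRing R] {A : Tower.{u} R}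

theorem hasBasis_nhds_K0 (e : A.K0) :
    (𝓝 e).HasBasis (fun _ : ℕ => True) fun m => {f : A.K0 | ∀ n, n ≤ m → f n = e n} := by
  let _ : ∀ i, TopologicalSpace (A.obj i) := fun _ => ⊥
  have : ∀ i, DiscreteTopology (A.obj i) := fun _ => ⟨rfl⟩
  exact hasBasis_nhds_pi_of_discrete (M := A.obj) (fun n => n) (fun m => Set.finite_Iic m) e

theorem hasBasis_nhds_Z1 (c : A.Z1) : (𝓝 c).HasBasis (fun _ : ℕ => True) fun m =>
    {c' : A.Z1 | ∀ {n k : ℕ} (h : n ≤ k), k ≤ m → A.coef h c' = A.coef h c} := by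
  let _ : ∀ i, TopologicalSpace (A.obj i) := fun _ => ⊥
  have : ∀ i, DiscreteTopology (A.obj i) := fun _ => ⟨rfl⟩
  have h1 : (𝓝 c.1).HasBasis (fun _ : ℕ => True) fun m =>
      {c' : A.K1 | ∀ l : {l : ℕ × ℕ // l.1 ≤ l.2}, l.1.2 ≤ m → c' l = c.1 l} := by
    refine hasBasis_nhds_pi_of_discrete (M := fun l : {l : ℕ × ℕ // l.1 ≤ l.2} => A.obj l.1.1)
      (fun l => l.1.2) (fun m => ?_) c.1
    refine Set.Finite.of_finite_image (f := Subtype.val)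
      (((Set.finite_Iic m).prod (Set.finite_Iic m)).subset ?_) Subtype.val_injective.injOn
    rintro _ ⟨l, hl, rfl⟩
    exact ⟨l.2.trans hl, hl⟩
  rw [nhds_subtype_eq_comap]
  refine (h1.comap _).to_hasBasis (fun m _ => ⟨m, trivial, fun c' hc' l hl => hc' l.2 hl⟩)
    (fun m _ => ⟨m, trivial, fun c' hc' n k h hk => hc' ⟨(n, k), h⟩ hk⟩)

theorem hasBasis_nhds_submodule_K0 {S : Submodule R A.K0} (e : S) :
    (𝓝 e).HasBasis (fun _ : ℕ => True) fun m => {f : S | ∀ n, n ≤ m → f.1 n = e.1 n} := by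
  rw [nhds_subtype_eq_comap]
  exact (hasBasis_nhds_K0 e.1).comap _

theorem hasBasis_nhds_submodule_Z1 {S : Submodule R A.Z1} (c : S) :
    (𝓝 c).HasBasis (fun _ : ℕ => True) fun m =>
      {c' : S | ∀ {n k : ℕ} (h : n ≤ k), k ≤ m → A.coef h c'.1 = A.coef h c.1} := by
  rw [nhds_subtype_eq_comap]
  exact (hasBasis_nhds_Z1 c.1).comap _

theorem mem_of_isClosed_Z1 {S : Submodule R A.Z1} {F : Set S} (hF : IsClosed F) {c : S} {m₀ : ℕ}
    (h : ∀ m, m₀ ≤ m → ∃ c' ∈ F, ∀ {n k : ℕ} (h : n ≤ k), k ≤ m →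
      A.coef h c'.1 = A.coef h c.1) : c ∈ F := by
  rw [← hF.closure_eq, mem_closure_iff_nhds_basis (hasBasis_nhds_submodule_Z1 c)]
  intro m _
  obtain ⟨c', hc', hcc⟩ := h (max m m₀) (le_max_right _ _)
  exact ⟨c', hc', fun h hk => hcc h (hk.trans (le_max_left _ _))⟩

theorem continuous_d1Z : Continuous A.d1Z := A.continuous_d1.subtype_mk _

theorem continuous_coef {n m : ℕ} (h : n ≤ m) : @Continuous A.Z1 (A.obj n) _ ⊥ (A.coef h) := by
  let _ : ∀ i, TopologicalSpace (A.obj i) := fun _ => ⊥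
  exact (A.continuous_eval_K1 ⟨(n, m), h⟩).comp continuous_subtype_val

theorem isClosed_cochainsIn (D : ∀ n, Submodule R (A.obj n)) :
    IsClosed (A.cochainsIn D : Set A.K0) := by
  let _ : ∀ i, TopologicalSpace (A.obj i) := fun _ => ⊥
  have : ∀ i, DiscreteTopology (A.obj i) := fun _ => ⟨rfl⟩
  have : (A.cochainsIn D : Set A.K0) = ⋂ n, (fun e : A.K0 => e n) ⁻¹' (D n) := by
    ext e; simp [mem_cochainsIn]
  rw [this]
  exact isClosed_iInter fun n => (isClosed_discrete _).preimage (A.continuous_eval_K0 n)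

theorem isClosed_cocyclesIn (D : ∀ n, Submodule R (A.obj n)) :
    IsClosed (A.cocyclesIn D : Set A.Z1) := by
  let _ : ∀ i, TopologicalSpace (A.obj i) := fun _ => ⊥
  have : ∀ i, DiscreteTopology (A.obj i) := fun _ => ⟨rfl⟩
  rw [cocyclesIn, Submodule.coe_iInf]
  exact isClosed_iInter fun l => (isClosed_discrete _).preimage (continuous_coef l.2)

theorem dense_B1 : Dense (A.B1 : Set A.Z1) := fun c => by
  rw [mem_closure_iff_nhds_basis (hasBasis_nhds_Z1 c)]
  exact fun m _ => ⟨A.d1Z (primitive c m 0), d1Z_mem_B1 _,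
    fun h hk => coef_d1Z_primitive c 0 h hk⟩

/-! ### A Polish model of the saturation of a subtower -/

variable {D D' : ∀ n, Submodule R (A.obj n)}

variable (A) in
/-- The cochains `K⁰(A / D)` of the quotient of `A` by the submodules `D n`. -/
def quotK0 (D : ∀ n, Submodule R (A.obj n)) : Type u := ∀ n, A.obj n ⧸ D n

instance : AddCommGroup (A.quotK0 D) := inferInstanceAs (AddCommGroup (∀ n, A.obj n ⧸ D n))
instance : Module R (A.quotK0 D) := inferInstanceAs (Module R (∀ n, A.obj n ⧸ D n))

/-- The product topology, where every quotient is discrete. -/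
instance : TopologicalSpace (A.quotK0 D) :=
  @Pi.topologicalSpace ℕ (fun n => A.obj n ⧸ D n) (fun _ => ⊥)

theorem isPolishModule_quotK0 [∀ n, Countable (A.obj n)] : IsPolishModule R (A.quotK0 D) :=
  have (n : ℕ) : Countable (A.obj n ⧸ D n) := (D n).mkQ_surjective.countable
  isPolishModule_pi (R := R) (fun n => A.obj n ⧸ D n)

/-- The projection `K⁰(A) → K⁰(A / D)`. -/
def toQuotK0 (D : ∀ n, Submodule R (A.obj n)) : A.K0 →ₗ[R] A.quotK0 D where
  toFun e n := (D n).mkQ (e n)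
  map_add' _ _ := rfl
  map_smul' _ _ := rfl

theorem toQuotK0_surjective : Function.Surjective (toQuotK0 D) := by
  intro q
  choose e he using fun n => (D n).mkQ_surjective (q n)
  exact ⟨e, funext he⟩

theorem toQuotK0_eq_zero {e : A.K0} : toQuotK0 D e = 0 ↔ e ∈ A.cochainsIn D := by
  refine ⟨fun h n => ?_, fun h => funext fun n => ?_⟩
  · exact (Submodule.Quotient.mk_eq_zero _).1 (congrFun h n)
  · exact (Submodule.Quotient.mk_eq_zero _).2 (h n)

/-- The defect `c_{nm} - (p ēₘ - ēₙ) ∈ A⁽ⁿ⁾ / D n` of a pair of a cocycle `c` of `A` and a cochain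
`ē` of `A / D`. -/
def defect (hD : A.IsSubtower D) {n m : ℕ} (h : n ≤ m) :
    A.Z1 × A.quotK0 D →ₗ[R] A.obj n ⧸ D n where
  toFun w := (D n).mkQ (A.coef h w.1) -
    ((D m).mapQ (D n) (A.p h) (fun x hx => hD _ _ h x hx) (w.2 m) - w.2 n)
  map_add' w w' := by
    change _ - ((D m).mapQ (D n) (A.p h) _ (w.2 m + w'.2 m) - (w.2 n + w'.2 n)) = _
    rw [Prod.fst_add, map_add, map_add, map_add]
    abel
  map_smul' r w := by
    change _ - ((D m).mapQ (D n) (A.p h) _ (r • w.2 m) - r • w.2 n) = r • _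
    rw [Prod.smul_fst, map_smul, map_smul, map_smul, smul_sub, smul_sub]

/-- The pairs `(c, ē)` where `ē ∈ K⁰(A / D)` has as coboundary the image of `c` in `A / D`. When
`lim (A / D) = 0`, the cochain `ē` is determined by `c`, and this is a Polish model of
`coboundarySat D`. -/
def satModel (hD : A.IsSubtower D) : Submodule R (A.Z1 × A.quotK0 D) :=
  ⨅ l : {l : ℕ × ℕ // l.1 ≤ l.2}, LinearMap.ker (defect hD l.2)

theorem mem_satModel {hD : A.IsSubtower D} {c : A.Z1} {e : A.K0} :
    (c, toQuotK0 D e) ∈ satModel hD ↔ c - A.d1Z e ∈ A.cocyclesIn D := by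
  have key : ∀ {n m : ℕ} (h : n ≤ m), defect hD h (c, toQuotK0 D e) = 0 ↔
      A.coef h (c - A.d1Z e) ∈ D n := fun {n m} h => by
    rw [map_sub, coef_d1Z, ← Submodule.Quotient.mk_eq_zero]
    rfl
  rw [satModel, Submodule.mem_iInf, mem_cocyclesIn]
  exact ⟨fun h n m hnm => (key hnm).1 (LinearMap.mem_ker.1 (h ⟨(n, m), hnm⟩)),
    fun h l => LinearMap.mem_ker.2 ((key l.2).2 (h l.2))⟩

theorem continuous_eval_quotK0 (n : ℕ) :
    @Continuous (A.quotK0 D) (A.obj n ⧸ D n) _ ⊥ (fun q => q n) := by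
  let _ : ∀ i, TopologicalSpace (A.obj i ⧸ D i) := fun _ => ⊥
  exact continuous_apply (A := fun i => A.obj i ⧸ D i) n

/-- A condition on `c_{nm}`, `ēₙ` and `ēₘ` defines a closed set of pairs `(c, ē)`. -/
theorem isClosed_setOf_coef_quotK0 {n m : ℕ} (h : n ≤ m)
    (P : A.obj n → A.obj n ⧸ D n → A.obj m ⧸ D m → Prop) :
    IsClosed {w : A.Z1 × A.quotK0 D | P (A.coef h w.1) (w.2 n) (w.2 m)} := by
  let _ : ∀ i, TopologicalSpace (A.obj i) := fun _ => ⊥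
  let _ : ∀ i, TopologicalSpace (A.obj i ⧸ D i) := fun _ => ⊥
  have : ∀ i, DiscreteTopology (A.obj i) := fun _ => ⟨rfl⟩
  have : ∀ i, DiscreteTopology (A.obj i ⧸ D i) := fun _ => ⟨rfl⟩
  have h1 : Continuous fun w : A.Z1 × A.quotK0 D => (A.coef h w.1, w.2 n, w.2 m) :=
    ((continuous_coef h).comp continuous_fst).prodMk
      (((continuous_eval_quotK0 n).comp continuous_snd).prodMk
        ((continuous_eval_quotK0 m).comp continuous_snd))
  exact (isClosed_discrete {t : A.obj n × (A.obj n ⧸ D n) × (A.obj m ⧸ D m) |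
    P t.1 t.2.1 t.2.2}).preimage h1

theorem isPolishModule_satModel [∀ n, Countable (A.obj n)] (hD : A.IsSubtower D) :
    IsPolishModule R (satModel hD) := by
  refine (A.isPolishModule_Z1.prod isPolishModule_quotK0).submodule _ ?_
  rw [satModel, Submodule.coe_iInf]
  exact isClosed_iInter fun l => isClosed_setOf_coef_quotK0 l.2
    (fun x y z => (D _).mkQ x -
      ((D _).mapQ (D _) (A.p l.2) (fun x hx => hD _ _ l.2 x hx) z - y) = 0)

/-- The projection of `satModel` to `Z¹(A)`. -/
def satModelFst (hD : A.IsSubtower D) : satModel hD →ₗ[R] A.Z1 :=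
  LinearMap.fst R _ _ ∘ₗ (satModel hD).subtype

theorem continuous_satModelFst (hD : A.IsSubtower D) : Continuous (satModelFst hD) :=
  continuous_fst.comp continuous_subtype_val

theorem range_satModelFst (hD : A.IsSubtower D) :
    LinearMap.range (satModelFst hD) = A.coboundarySat D := by
  ext c
  rw [mem_coboundarySat]
  constructor
  · rintro ⟨⟨⟨c, q⟩, hw⟩, rfl⟩
    obtain ⟨e, rfl⟩ := toQuotK0_surjective q
    exact ⟨_, mem_satModel.1 hw, e, sub_add_cancel _ _⟩
  · rintro ⟨c', hc', e, rfl⟩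
    have h : (c' + A.d1Z e) - A.d1Z e ∈ A.cocyclesIn D := by rwa [add_sub_cancel_right]
    exact ⟨⟨(_, toQuotK0 D e), mem_satModel.2 h⟩, rfl⟩

variable (A) in
/-- `lim (A / D) = 0`. -/
def QuotReduced (D : ∀ n, Submodule R (A.obj n)) : Prop :=
  ∀ e : A.K0, A.d1Z e ∈ A.cocyclesIn D → e ∈ A.cochainsIn D

theorem satModelFst_injective (hD : A.IsSubtower D) (hq : A.QuotReduced D) :
    Function.Injective (satModelFst hD) := by
  rw [injective_iff_map_eq_zero]
  rintro ⟨⟨c, q⟩, hw⟩ (rfl : c = 0)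
  obtain ⟨e, rfl⟩ := toQuotK0_surjective q
  have h1 := mem_satModel.1 hw
  rw [_root_.zero_sub, neg_mem_iff] at h1
  have h2 := toQuotK0_eq_zero.2 (hq e h1)
  exact Subtype.ext (Prod.ext rfl h2)

theorem isPolishable_coboundarySat [∀ n, Countable (A.obj n)] (hD : A.IsSubtower D)
    (hq : A.QuotReduced D) : IsPolishable (A.coboundarySat D) := by
  obtain ⟨τ, hτ, -⟩ := (isPolishModule_satModel hD).exists_isPolishTopologyOn
    (continuous_satModelFst hD) (satModelFst_injective hD hq) (range_satModelFst hD)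
  exact ⟨τ, hτ⟩

/-- The inclusion of the cocycles with values in `D` in the Polish model. -/
def cocyclesInToSatModel (hD : A.IsSubtower D) (c : A.cocyclesIn D) : satModel hD :=
  ⟨(c.1, 0), by
    have h := mem_satModel (hD := hD) (c := c.1) (e := 0)
    rw [map_zero, map_zero, _root_.sub_zero] at h
    exact h.2 c.2⟩

theorem continuous_cocyclesInToSatModel (hD : A.IsSubtower D) :
    Continuous (cocyclesInToSatModel hD) :=
  (continuous_subtype_val.prodMk continuous_const).subtype_mk _

/-! ### Upper bounds for the complexity -/

/-- The set of the `(c, ē)` such that, for all `m ≥ n`, some `e` in the coset `ēₘ` satisfies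
`x + p e = c_{nm}`. -/
def approxSet (hD : A.IsSubtower D) (n : ℕ) (x : A.obj n) : Set (satModel hD) :=
  {w | ∀ {m : ℕ} (h : n ≤ m), ∃ e : A.obj m, (D m).mkQ e = w.1.2 m ∧ x + A.p h e = A.coef h w.1.1}

theorem isClosed_approxSet (hD : A.IsSubtower D) (n : ℕ) (x : A.obj n) :
    IsClosed (approxSet hD n x) := by
  have : approxSet hD n x = ⋂ m : {m // n ≤ m}, Subtype.val ⁻¹'
      {w : A.Z1 × A.quotK0 D | ∃ e : A.obj m.1, (D m.1).mkQ e = w.2 m.1 ∧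
        x + A.p m.2 e = A.coef m.2 w.1} := by
    ext w
    simp only [Set.mem_iInter, Subtype.forall]
    exact Iff.rfl
  rw [this]
  exact isClosed_iInter fun m => (isClosed_setOf_coef_quotK0 m.2
    (fun a _ q => ∃ e : A.obj m.1, (D m.1).mkQ e = q ∧ x + A.p m.2 e = a)).preimage
      continuous_subtype_val

theorem mem_approxSet {hD : A.IsSubtower D} {n : ℕ} {x : A.obj n} {c : A.Z1} {e : A.K0}
    (hw : (c + A.d1Z e, toQuotK0 D e) ∈ satModel hD) :
    ⟨_, hw⟩ ∈ approxSet hD n x ↔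
      ∀ {m : ℕ} (h : n ≤ m), ∃ y ∈ D m, x + e n + A.p h y = A.coef h c := by
  refine forall₂_congr fun m h => ?_
  change (∃ f : A.obj m, (D m).mkQ f = (D m).mkQ (e m) ∧
    x + A.p h f = A.coef h (c + A.d1Z e)) ↔ _
  rw [map_add, coef_d1Z]
  constructor
  · rintro ⟨f, hf, hx⟩
    refine ⟨f - e m, (Submodule.Quotient.eq _).1 hf, ?_⟩
    rw [map_sub, eq_sub_of_add_eq hx]
    abel
  · rintro ⟨y, hy, hx⟩
    refine ⟨e m + y, (Submodule.Quotient.eq _).2 (by simpa using hy), ?_⟩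
    rw [← hx, map_add]
    abel

variable (A) in
/-- `D'` is the derived family `⋂ₘ p(D m)` of `D`. -/
def IsDerivedOf (D' D : ∀ n, Submodule R (A.obj n)) : Prop :=
  ∀ (n : ℕ) (x : A.obj n), x ∈ D' n ↔ ∀ {m : ℕ} (h : n ≤ m), ∃ y ∈ D m, A.p h y = x

theorem IsDerivedOf.le (hDD : A.IsDerivedOf D' D) (n : ℕ) : D' n ≤ D n := by
  intro x hx
  obtain ⟨y, hy, rfl⟩ := (hDD _ _).1 hx le_rfl
  rwa [A.p_self]

/-- Write the cocycle as `c + d e` with `c` in `D`. Given solutions `xₙ` at all levels `n`, the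
cochain `z = x + e` satisfies `c_{nm} ≡ zₙ` modulo `p(D m)`, so that `c + d z` has values
in `D'`. -/
theorem preimage_coboundarySat_eq_iInter (hD : A.IsSubtower D) (hq : A.QuotReduced D)
    (hDD : A.IsDerivedOf D' D) :
    satModelFst hD ⁻¹' (A.coboundarySat D') = ⋂ n, ⋃ x, approxSet hD n x := by
  ext ⟨⟨c, q⟩, hw⟩
  obtain ⟨e, rfl⟩ := toQuotK0_surjective q
  obtain ⟨c, rfl⟩ : ∃ c', c = c' + A.d1Z e := ⟨c - A.d1Z e, (sub_add_cancel _ _).symm⟩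
  have hc : c ∈ A.cocyclesIn D := by simpa using mem_satModel.1 hw
  simp only [Set.mem_preimage, Set.mem_iInter, Set.mem_iUnion, mem_approxSet hw]
  change c + A.d1Z e ∈ A.coboundarySat D' ↔ _
  rw [mem_coboundarySat]
  constructor
  · rintro ⟨c', hc', f, hf⟩ n
    have hcf : c = c' + A.d1Z (f - e) := by
      rw [map_sub, add_sub, hf, add_sub_cancel_right]
    have hfe : f - e ∈ A.cochainsIn D := hq _ (by
      rw [eq_sub_of_add_eq' hcf.symm]
      exact sub_mem hc (cocyclesIn_mono hDD.le hc'))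
    refine ⟨-f n, fun {m} h => ?_⟩
    obtain ⟨y, hy, hyc⟩ := (hDD _ _).1 (mem_cocyclesIn.1 hc' h) h
    refine ⟨(f - e) m + y, add_mem (hfe m) hy, ?_⟩
    rw [hcf, map_add, map_add, coef_d1Z, hyc, K0_sub_apply f e n]
    abel
  · intro h
    choose x hx using h
    let z : A.K0 := fun n => x n + e n
    refine ⟨c + A.d1Z z, mem_cocyclesIn.2 fun {n m} hnm => (hDD _ _).2 fun {k} hk => ?_, e - z, ?_⟩
    · have key : ∀ k, m ≤ k → ∃ y ∈ D k, ∀ hk : n ≤ k, A.p hk y = A.coef hnm (c + A.d1Z z) := by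
        intro k hmk
        obtain ⟨y, hy, hyc⟩ := hx n (hnm.trans hmk)
        obtain ⟨y', hy', hyc'⟩ := hx m hmk
        refine ⟨y - y', sub_mem hy hy', fun hk => ?_⟩
        have h1 := coef_trans hnm hmk c
        rw [← hyc, ← hyc', map_add, A.p_comp] at h1
        rw [map_add, coef_d1Z, map_sub]
        change _ = _ + (A.p hnm (x m + e m) - (x n + e n))
        rw [eq_sub_of_add_eq h1.symm]
        abel
      rcases le_total m k with hmk | hmk
      · obtain ⟨y, hy, hy'⟩ := key k hmk
        exact ⟨y, hy, hy' hk⟩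
      · obtain ⟨y, hy, hy'⟩ := key m le_rfl
        exact ⟨A.p hmk y, hD _ _ hmk y hy, by rw [A.p_comp, hy']⟩
    · rw [map_sub]
      abel

end Tower

namespace Tower

variable {R : Type v} [CommRing R] {A : Tower.{u} R} {D D' : ∀ n, Submodule R (A.obj n)}

variable (A) in
/-- For every `n` and all large `m`, the kernel of `D m → D n₀` is contained in that of `D m → D n`.
A subtower `D` is essentially monomorphic when this holds for some `n₀`. -/
def EssMonoFrom (D : ∀ n, Submodule R (A.obj n)) (n₀ : ℕ) : Prop :=
  ∀ n, ∃ m, ∃ (h₀ : n₀ ≤ m) (h : n ≤ m), ∀ y ∈ D m, A.p h₀ y = 0 → A.p h y = 0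

/-- If the coefficients `c_{n₀m}` are solvable in `D` up to a constant `z`, then the solutions
`yₘ ∈ D m` glue to the primitive `eₙ = p yₘ - c_{nm}`, where the right-hand side does not depend on
the large index `m`. -/
theorem EssMonoFrom.mem_B1 {n₀ : ℕ} (hE : A.EssMonoFrom D n₀) (hD : A.IsSubtower D) {c : A.Z1}
    (hc : c ∈ A.cocyclesIn D) (z : A.obj n₀)
    (hz : ∀ {m : ℕ} (h : n₀ ≤ m), ∃ y ∈ D m, z + A.p h y = A.coef h c) : c ∈ A.B1 := by
  have hz' : ∀ m, ∃ y ∈ D m, ∀ h : n₀ ≤ m, z + A.p h y = A.coef h c := by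
    intro m
    by_cases h : n₀ ≤ m
    · obtain ⟨y, hy, hyc⟩ := hz h
      exact ⟨y, hy, fun _ => hyc⟩
    · exact ⟨0, zero_mem _, fun h' => absurd h' h⟩
  choose y hy hyz using hz'
  choose M h₀M hM hker using hE
  let e : A.K0 := fun n => A.p (hM n) (y (M n)) - A.coef (hM n) c
  have key : ∀ {n m : ℕ} (h : n ≤ m) (_ : M n ≤ m), A.p h (y m) - A.coef h c = e n := by
    intro n m h hm
    have hu : A.p hm (y m) - y (M n) - A.coef hm c ∈ D (M n) :=
      sub_mem (sub_mem (hD _ _ hm _ (hy m)) (hy _)) (mem_cocyclesIn.1 hc hm)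
    have h0 := hker n _ hu (by
      have h1 := hyz m ((h₀M n).trans hm)
      rw [coef_trans (h₀M n) hm, ← hyz _ (h₀M n), add_assoc, add_left_cancel_iff] at h1
      rw [map_sub, map_sub, A.p_comp, h1]
      abel)
    rw [map_sub, map_sub, A.p_comp] at h0
    change _ = A.p (hM n) (y (M n)) - A.coef (hM n) c
    rw [coef_trans (hM n) hm, ← sub_eq_zero, ← h0]
    abel
  refine ⟨e, Z1_ext fun {n k} h => ?_⟩
  have hk : k ≤ max k (max (M n) (M k)) := le_max_left _ _
  rw [coef_d1Z, ← key hk ((le_max_right _ _).trans (le_max_right _ _)),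
    ← key (h.trans hk) ((le_max_left _ _).trans (le_max_right _ _)), coef_trans h hk, map_sub,
    A.p_comp]
  abel

/-- When `EssMonoFrom D n₀` holds, the condition at the single level `n₀` characterizes the
coboundaries. -/
theorem preimage_B1_eq_iUnion (hD : A.IsSubtower D) (hq : A.QuotReduced D)
    (hDD : A.IsDerivedOf D' D) {n₀ : ℕ} (hE : A.EssMonoFrom D n₀) :
    satModelFst hD ⁻¹' A.B1 = ⋃ x, approxSet hD n₀ x := by
  refine Set.Subset.antisymm (fun w hw => ?_) ?_
  · have h : w ∈ satModelFst hD ⁻¹' (A.coboundarySat D') := B1_le_coboundarySat hw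
    rw [preimage_coboundarySat_eq_iInter hD hq hDD] at h
    exact Set.mem_iInter.1 h n₀
  · refine Set.iUnion_subset fun x => ?_
    rintro ⟨⟨c, q⟩, hw⟩ hx
    obtain ⟨e, rfl⟩ := toQuotK0_surjective q
    obtain ⟨c, rfl⟩ : ∃ c', c = c' + A.d1Z e := ⟨c - A.d1Z e, (sub_add_cancel _ _).symm⟩
    rw [mem_approxSet] at hx
    have hc : c ∈ A.cocyclesIn D := by simpa using mem_satModel.1 hw
    exact add_mem (hE.mem_B1 hD hc _ hx) (d1Z_mem_B1 e)

/-! ### The lower bound, by Baire category -/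

theorem isPolishModule_cochainsIn [∀ n, Countable (A.obj n)] (D : ∀ n, Submodule R (A.obj n)) :
    IsPolishModule R (A.cochainsIn D) :=
  A.isPolishModule_K0.submodule _ (isClosed_cochainsIn D)

theorem isPolishModule_cocyclesIn [∀ n, Countable (A.obj n)] (D : ∀ n, Submodule R (A.obj n)) :
    IsPolishModule R (A.cocyclesIn D) :=
  A.isPolishModule_Z1.submodule _ (isClosed_cocyclesIn D)

instance : IsTopologicalAddGroup A.K1 := by
  let _ : ∀ i, TopologicalSpace (A.obj i) := fun _ => ⊥
  have : ∀ i, DiscreteTopology (A.obj i) := fun _ => ⟨rfl⟩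
  exact inferInstanceAs (IsTopologicalAddGroup (∀ l : {l : ℕ × ℕ // l.1 ≤ l.2}, A.obj l.1.1))

/-- The map `(c, e) ↦ c + d e`. -/
def cocycleAddCoboundary (hD : A.IsSubtower D) (hle : ∀ n, D' n ≤ D n)
    (w : A.cocyclesIn D' × A.cochainsIn D) : A.cocyclesIn D :=
  ⟨w.1.1 + A.d1Z w.2.1, add_mem (cocyclesIn_mono hle w.1.2) (hD.d1Z_mem w.2.2)⟩

theorem continuous_cocycleAddCoboundary (hD : A.IsSubtower D) (hle : ∀ n, D' n ≤ D n) :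
    Continuous (cocycleAddCoboundary hD hle) :=
  ((continuous_subtype_val.comp continuous_fst).add
    (continuous_d1Z.comp (continuous_subtype_val.comp continuous_snd))).subtype_mk _

/-- Let `F` be closed and contain all the cocycles `c + d e`, where `e` has fixed coordinates up to
`m₀`. Then `F` contains the `c' + d e` for all `c'` with values in the derived family that agree
with `c` up to `m₀`: the coefficients `(c' - c)_{m₀m}` lift to `D m`, so that `c' - c` is
approximated by coboundaries of cochains which vanish up to `m₀`. -/
theorem cocycleAddCoboundary_mem_of_isClosed (hD : A.IsSubtower D) (hDD : A.IsDerivedOf D' D)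
    {F : Set (A.cocyclesIn D)} (hF : IsClosed F) {c : A.cocyclesIn D'} {e₁ : A.cochainsIn D}
    {m₀ : ℕ} (h : ∀ e : A.cochainsIn D, (∀ n, n ≤ m₀ → e.1 n = e₁.1 n) →
      cocycleAddCoboundary hD hDD.le (c, e) ∈ F)
    {c' : A.cocyclesIn D'} {e : A.cochainsIn D}
    (hc : ∀ {n k : ℕ} (h : n ≤ k), k ≤ m₀ → A.coef h c'.1 = A.coef h c.1)
    (he : ∀ n, n ≤ m₀ → e.1 n = e₁.1 n) : cocycleAddCoboundary hD hDD.le (c', e) ∈ F := by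
  refine mem_of_isClosed_Z1 hF (m₀ := m₀) fun m hm => ?_
  have hb : c'.1 - c.1 ∈ A.cocyclesIn D' := sub_mem c'.2 c.2
  obtain ⟨y, hy, hyb⟩ := (hDD _ _).1 (mem_cocyclesIn.1 hb hm) hm
  let g : A.cochainsIn D :=
    ⟨primitive (c'.1 - c.1) m y, hD.primitive_mem (cocyclesIn_mono hDD.le hb) hy⟩
  have hg : ∀ n, n ≤ m₀ → g.1 n = 0 := by
    intro n hn
    change primitive (c'.1 - c.1) m y n = 0
    have h0 : A.coef hn (c'.1 - c.1) = 0 := by rw [map_sub, hc hn le_rfl, _root_.sub_self]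
    rw [primitive_apply _ y (hn.trans hm), coef_trans hn hm, h0, ← hyb, A.p_comp, zero_add,
      _root_.sub_self]
  refine ⟨_, h (e + g) fun n hn => ?_, fun {n k} hnk hk => ?_⟩
  · change e.1 n + g.1 n = e₁.1 n
    rw [hg n hn, add_zero, he n hn]
  · change A.coef hnk (c.1 + A.d1Z (e.1 + g.1)) = A.coef hnk (c'.1 + A.d1Z e.1)
    rw [map_add, map_add, map_add, map_add, coef_d1Z_primitive (c'.1 - c.1) y hnk hk, map_sub]
    abel

/-- A `Π⁰₃` submodule `K` that contains the coboundaries contains the cocycles with values in the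
derived family: the set of the `(c, e)` with `c + d e ∈ K` is comeagre in the Polish group
`Z¹(D') × K⁰(D)`, and a comeagre subgroup is the whole group. -/
theorem cocyclesIn_le_of_isPi03 [∀ n, Countable (A.obj n)] (hD : A.IsSubtower D)
    (hDD : A.IsDerivedOf D' D) {K : Submodule R A.Z1} (hK : A.B1 ≤ K)
    (hPi : IsPi03 {c : A.cocyclesIn D | c.1 ∈ K}) : A.cocyclesIn D' ≤ K := by
  obtain ⟨S, hS, hKS⟩ := hPi
  choose F hF hSF using hS
  obtain ⟨_, _, -⟩ := isPolishModule_cocyclesIn D'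
  obtain ⟨_, _, -⟩ := isPolishModule_cochainsIn D
  let q := cocycleAddCoboundary hD hDD.le
  have hq : Continuous q := continuous_cocycleAddCoboundary hD hDD.le
  have key : ∀ n, Dense (⋃ j, interior (q ⁻¹' F n j)) := by
    intro n
    rw [dense_iff_inter_open]
    rintro O hO ⟨⟨c₀, e₀⟩, hO₀⟩
    obtain ⟨⟨i₁, i₂⟩, -, hi⟩ := ((hasBasis_nhds_submodule_Z1 c₀).prod_nhds
      (hasBasis_nhds_submodule_K0 e₀)).mem_iff.1 (hO.mem_nhds hO₀)
    obtain ⟨m₀, hi₁, hi₂⟩ : ∃ m, i₁ ≤ m ∧ i₂ ≤ m := ⟨_, le_max_left _ _, le_max_right _ _⟩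
    have hD' : A.IsSubtower D' := fun n m h x hx => (hDD _ _).2 fun {k} hk => by
      obtain ⟨y, hy, hyx⟩ := (hDD _ _).1 hx (le_max_left m k)
      exact ⟨_, hD _ _ (le_max_right m k) y hy, by rw [A.p_comp, ← hyx, A.p_comp]⟩
    -- The coboundaries of cochains with values in `D'` are dense in `Z¹(D')`.
    let f : A.K0 := primitive c₀.1 m₀ 0
    have hf : f ∈ A.cochainsIn D' := hD'.primitive_mem c₀.2 (zero_mem _)
    let c : A.cocyclesIn D' := ⟨A.d1Z f, hD'.d1Z_mem hf⟩
    let E : ℕ → Set (A.cochainsIn D) := fun j => {e | q (c, e) ∈ F n j}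
    have hE : ∀ j, IsClosed (E j) := fun j =>
      (hF n j).preimage (hq.comp (continuous_const.prodMk continuous_id))
    have hcov : (⋃ j, E j) = Set.univ := by
      refine Set.eq_univ_of_forall fun e => ?_
      have h1 : q (c, e) ∈ {c : A.cocyclesIn D | c.1 ∈ K} :=
        hK (add_mem (d1Z_mem_B1 f) (d1Z_mem_B1 e.1))
      rw [hKS] at h1
      have h2 := Set.mem_iInter.1 h1 n
      rw [hSF n] at h2
      obtain ⟨j, hj⟩ := Set.mem_iUnion.1 h2
      exact Set.mem_iUnion.2 ⟨j, hj⟩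
    obtain ⟨e₁, he₁, he₁'⟩ := (dense_iUnion_interior_of_closed hE hcov).inter_nhds_nonempty
      ((hasBasis_nhds_submodule_K0 e₀).mem_of_mem (i := m₀) trivial)
    obtain ⟨j, hj⟩ := Set.mem_iUnion.1 he₁
    obtain ⟨m₁, -, hm₁⟩ := (hasBasis_nhds_submodule_K0 e₁).mem_iff.1
      (mem_interior_iff_mem_nhds.1 hj)
    refine ⟨(c, e₁), hi ⟨fun h hk => ?_, fun n hn => he₁' n (hn.trans hi₂)⟩,
      Set.mem_iUnion.2 ⟨j, mem_interior_iff_mem_nhds.2 ?_⟩⟩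
    · exact coef_d1Z_primitive c₀.1 0 h (hk.trans hi₁)
    · refine Filter.mem_of_superset (prod_mem_nhds
        ((hasBasis_nhds_submodule_Z1 c).mem_of_mem (i := m₁) trivial)
        ((hasBasis_nhds_submodule_K0 e₁).mem_of_mem (i := m₁) trivial)) ?_
      rintro ⟨c', e⟩ ⟨hc', he⟩
      exact cocycleAddCoboundary_mem_of_isClosed hD hDD (hF n j) (fun e he => hm₁ he)
        hc' he
  have hres : ∀ᶠ w in residual (A.cocyclesIn D' × A.cochainsIn D), (q w).1 ∈ K := by
    have h1 : ∀ n, ∀ᶠ w in residual (A.cocyclesIn D' × A.cochainsIn D), q w ∈ S n := fun n => by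
      filter_upwards [residual_of_dense_open (isOpen_iUnion fun j => isOpen_interior) (key n)]
        with w hw
      obtain ⟨j, hj⟩ := Set.mem_iUnion.1 hw
      rw [hSF n]
      exact Set.mem_iUnion.2 ⟨j, interior_subset (s := q ⁻¹' F n j) hj⟩
    filter_upwards [eventually_countable_forall.2 h1] with w hw
    have : q w ∈ ⋂ n, S n := Set.mem_iInter.2 hw
    rwa [← hKS] at this
  intro c hc
  let t := Homeomorph.addRight ((⟨c, hc⟩, 0) : A.cocyclesIn D' × A.cochainsIn D)
  have ht := (tendsto_residual_of_isOpenMap t.continuous t.isOpenMap).eventually hres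
  obtain ⟨w, hw, hw'⟩ := (dense_of_mem_residual (hres.and ht)).nonempty
  have h3 : (q (t w)).1 - (q w).1 = c := by
    change (w.1.1 + c + A.d1Z (w.2.1 + 0)) - (w.1.1 + A.d1Z w.2.1) = c
    rw [add_zero]
    abel
  rw [← h3]
  exact sub_mem hw' hw

/-! ### Reduced towers -/

theorem IsReduced.d1Z_injective (hA : A.IsReduced) : Function.Injective A.d1Z := by
  rw [injective_iff_map_eq_zero]
  intro e he
  have h : e ∈ A.lim := LinearMap.mem_ker.2 (congrArg Subtype.val he)
  rw [hA] at h
  exact h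

/-- If `A` is reduced and the closed submodule `Q` of `Z¹` consists of coboundaries, then `d` has a
continuous inverse on `Q`. -/
theorem IsReduced.exists_eq_zero_of_coef_eq_zero [∀ n, Countable (A.obj n)] (hA : A.IsReduced)
    {Q : Submodule R A.Z1} (hQ : IsClosed (Q : Set A.Z1)) (hQB : Q ≤ A.B1) (n : ℕ) :
    ∃ m, ∀ e : A.K0, A.d1Z e ∈ Q → (∀ {i k : ℕ} (h : i ≤ k), k ≤ m → A.coef h (A.d1Z e) = 0) →
      e n = 0 := by
  obtain ⟨_, _, -⟩ := A.isPolishModule_Z1.submodule Q hQ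
  obtain ⟨_, _, -⟩ := A.isPolishModule_K0.submodule (Q.comap A.d1Z) (hQ.preimage continuous_d1Z)
  let φ : Q.comap A.d1Z →ₗ[R] Q := A.d1Z.restrict fun e he => he
  have hφ : Continuous φ := (continuous_d1Z.comp continuous_subtype_val).subtype_mk _
  have hinj : Function.Injective φ := fun e f h =>
    Subtype.ext (hA.d1Z_injective (congrArg Subtype.val h))
  have hsurj : Function.Surjective φ := by
    rintro ⟨c, hc⟩
    obtain ⟨e, rfl⟩ := hQB hc
    exact ⟨⟨e, hc⟩, rfl⟩
  let ψ := (LinearEquiv.ofBijective φ ⟨hinj, hsurj⟩).symm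
  have hψ : Continuous ψ := AddMonoidHom.continuous_of_comp_injective hφ hinj
    (ψ : Q →+ Q.comap A.d1Z) (by
      have : φ ∘ ((ψ : Q →+ Q.comap A.d1Z)) = id := by
        funext c
        exact (LinearEquiv.ofBijective φ ⟨hinj, hsurj⟩).apply_symm_apply c
      rw [this]
      exact continuous_id)
  have h0 := hψ.tendsto 0
  rw [map_zero] at h0
  obtain ⟨m, -, hm⟩ := (hasBasis_nhds_submodule_Z1 (0 : Q)).mem_iff.1
    (h0 ((hasBasis_nhds_submodule_K0 0).mem_of_mem (i := n) trivial))
  refine ⟨m, fun e he hz => ?_⟩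
  have h1 : ψ (φ ⟨e, he⟩) = ⟨e, he⟩ :=
    (LinearEquiv.ofBijective φ ⟨hinj, hsurj⟩).symm_apply_apply _
  have h2 := @hm (φ ⟨e, he⟩) (fun {i k} h hk => (hz h hk).trans (map_zero _).symm)
  have h3 := h2 n le_rfl
  rwa [h1] at h3

/-- The cochain `p y` supported on the indices up to `m` has a coboundary that vanishes up to `m`,
so that `d` having a continuous inverse forces bonding maps to vanish. -/
theorem IsReduced.exists_p_eq_zero [∀ n, Countable (A.obj n)] (hA : A.IsReduced)
    (hD : A.IsSubtower D) (n₀ : ℕ)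
    (hQB : ∀ c ∈ A.cocyclesIn D,
      (∀ {i k : ℕ} (h : i ≤ k), i < n₀ → A.coef h c = 0) → c ∈ A.B1) (n : ℕ) :
    ∃ m, ∃ (_ : n₀ ≤ m) (h : n ≤ m), ∀ y ∈ D m,
      (∀ {i : ℕ} (h : i ≤ m), i < n₀ → A.p h y = 0) → A.p h y = 0 := by
  classical
  let D₀ : ∀ i, Submodule R (A.obj i) := fun i => if i < n₀ then ⊥ else D i
  have hQ : A.cocyclesIn D₀ ≤ A.B1 := fun c hc => hQB c
    (cocyclesIn_mono (fun i => by by_cases h : i < n₀ <;> simp [D₀, h]) hc) fun {i k} h hi => by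
      simpa [D₀, hi] using mem_cocyclesIn.1 hc h
  obtain ⟨m, hm⟩ := hA.exists_eq_zero_of_coef_eq_zero (isClosed_cocyclesIn D₀) hQ n
  refine ⟨max m (max n₀ n), (le_max_left _ _).trans (le_max_right _ _),
    (le_max_right _ _).trans (le_max_right _ _), fun y hy hy0 => ?_⟩
  have he : primitive 0 (max m (max n₀ n)) y ∈ A.cochainsIn D :=
    hD.primitive_mem (zero_mem _) hy
  have h1 := hm (primitive 0 (max m (max n₀ n)) y) (mem_cocyclesIn.2 fun {i k} h => ?_)
    fun {i k} h hk => ?_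
  · rwa [primitive_apply _ y ((le_max_right _ _).trans (le_max_right _ _)), map_zero,
      _root_.sub_zero] at h1
  · by_cases hi : i < n₀
    · have h2 : A.coef h (A.d1Z (primitive 0 (max m (max n₀ n)) y)) = 0 := by
        by_cases hk : k ≤ max m (max n₀ n)
        · rw [coef_d1Z_primitive 0 y h hk, map_zero]
        · have him : i ≤ max m (max n₀ n) :=
            hi.le.trans ((le_max_left _ _).trans (le_max_right _ _))
          rw [coef_d1Z, primitive_apply_of_lt _ y (not_le.1 hk), primitive_apply _ y him,
            hy0 him hi]
          simp
      rw [h2]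
      exact zero_mem _
    · simpa [D₀, hi] using mem_cocyclesIn.1 (hD.d1Z_mem he) h
  · rw [coef_d1Z_primitive 0 y h (hk.trans (le_max_left _ _)), map_zero]

/-- If the coboundaries are `Σ⁰₂` among the cocycles of `D`, then by the Baire category theorem all
the cocycles `c` with `c_{ik} = 0` for `i ≤ n₀`, for some `n₀`, are coboundaries. -/
theorem IsReduced.exists_essMonoFrom [∀ n, Countable (A.obj n)] (hA : A.IsReduced)
    (hD : A.IsSubtower D) (hS : IsSigma02 {c : A.cocyclesIn D | c.1 ∈ A.B1}) :
    ∃ n₀, A.EssMonoFrom D n₀ := by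
  obtain ⟨F, hF, hSF⟩ := hS
  obtain ⟨_, _, -⟩ := isPolishModule_cochainsIn D
  let q : A.cochainsIn D → A.cocyclesIn D := fun e => ⟨A.d1Z e.1, hD.d1Z_mem e.2⟩
  have hq : Continuous q := (continuous_d1Z.comp continuous_subtype_val).subtype_mk _
  have hcov : (⋃ j, q ⁻¹' F j) = Set.univ := by
    rw [← Set.preimage_iUnion, ← hSF]
    exact Set.eq_univ_of_forall fun e => d1Z_mem_B1 e.1
  obtain ⟨j, e₁, he₁⟩ := nonempty_interior_of_iUnion_of_closed (fun j => (hF j).preimage hq) hcov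
  obtain ⟨n₀, -, hn₀⟩ := (hasBasis_nhds_submodule_K0 e₁).mem_iff.1
    (mem_interior_iff_mem_nhds.1 he₁)
  have hB : ∀ c ∈ A.cocyclesIn D, (∀ {i k : ℕ} (h : i ≤ k), i < n₀ + 1 → A.coef h c = 0) →
      c ∈ A.B1 := by
    intro c hc hc0
    have h1 : (⟨c + A.d1Z e₁.1, add_mem hc (hD.d1Z_mem e₁.2)⟩ : A.cocyclesIn D) ∈ F j := by
      refine mem_of_isClosed_Z1 (hF j) (m₀ := n₀) fun m hm => ?_
      let g : A.cochainsIn D := ⟨primitive c m 0, hD.primitive_mem hc (zero_mem _)⟩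
      refine ⟨q (g + e₁), hn₀ fun i hi => ?_, fun h hk => ?_⟩
      · change primitive c m 0 i + e₁.1 i = e₁.1 i
        rw [primitive_apply c 0 (hi.trans hm), hc0 _ (Nat.lt_succ_iff.2 hi)]
        simp
      · change A.coef h (A.d1Z (g.1 + e₁.1)) = A.coef h (c + A.d1Z e₁.1)
        rw [map_add, map_add, map_add, coef_d1Z_primitive c 0 h hk]
    have h2 : (⟨c + A.d1Z e₁.1, add_mem hc (hD.d1Z_mem e₁.2)⟩ : A.cocyclesIn D) ∈
        {c : A.cocyclesIn D | c.1 ∈ A.B1} := by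
      rw [hSF]
      exact Set.mem_iUnion.2 ⟨j, h1⟩
    have h3 : c + A.d1Z e₁.1 ∈ A.B1 := h2
    simpa using sub_mem h3 (d1Z_mem_B1 e₁.1)
  refine ⟨n₀, fun n => ?_⟩
  obtain ⟨m, h₀, h, hm⟩ := hA.exists_p_eq_zero hD (n₀ + 1) hB n
  refine ⟨m, (Nat.le_succ _).trans h₀, h, fun y hy hy0 => hm y hy fun {i} him hi => ?_⟩
  rw [← A.p_comp (Nat.lt_succ_iff.1 hi) ((Nat.le_succ _).trans h₀), hy0, map_zero]

end Tower

theorem ModuleWithPolishCover.soleckiCover_zero {R : Type v} [CommRing R]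
    (G : ModuleWithPolishCover.{u} R) (h : Dense (G.N : Set G.Cover)) : G.soleckiCover 0 = ⊤ := by
  rw [soleckiCover, Ordinal.limitRecOn_zero]
  exact Submodule.dense_iff_topologicalClosure_eq_top.1 h

namespace Tower

variable {R : Type v} [CommRing R]

/-! ### Towers isomorphic to zero, and essentially monomorphic towers -/

theorem exists_monotone_ge (f : ℕ → ℕ) : ∃ g : ℕ → ℕ, Monotone g ∧ ∀ k, f k ≤ g k :=
  ⟨partialSups f, (partialSups f).monotone, le_partialSups f⟩

theorem ProHom.comm_of_le {A B : Tower.{u} R} (f : ProHom A B) {i j : ℕ} (h : i ≤ j)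
    (y : A.obj (f.idx j)) : B.p h (f.app j y) = f.app i (A.p (f.mono h) y) := by
  induction j, h using Nat.le_induction with
  | base => simp
  | succ j h ih => rw [← B.p_comp h (Nat.le_succ j), f.comm, ih, A.p_comp]

theorem isIsomorphic_zero_iff {B : Tower.{u} R} :
    B.IsIsomorphic (zero R) ↔ ∀ n, ∃ m, ∃ h : n ≤ m, ∀ y, B.p h y = 0 := by
  constructor
  · rintro ⟨f, g, ⟨m, -, hf, hg, h⟩, -⟩ n
    refine ⟨m n, hg n, fun y => (h n y).symm.trans ?_⟩
    exact (g.app n).map_zero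
  · intro h
    choose M hM h0 using h
    obtain ⟨m, hm, hMm⟩ := exists_monotone_ge M
    refine ⟨⟨fun k => k, monotone_id, fun _ => 0, fun _ _ => rfl⟩,
      ⟨fun k => k, monotone_id, fun _ => 0, fun k _ => (B.p _).map_zero⟩,
      ⟨m, hm, fun k => (hM k).trans (hMm k), fun k => (hM k).trans (hMm k), fun k x => ?_⟩,
      ⟨fun k => k, monotone_id, fun _ => le_rfl, fun _ => le_rfl, fun _ _ => rfl⟩⟩
    change 0 = B.p _ x
    rw [← B.p_comp (hM k) (hMm k), h0]

theorem IsMonomorphic.injective_p {B : Tower.{u} R} (hB : B.IsMonomorphic) {n m : ℕ} (h : n ≤ m) :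
    Function.Injective (B.p h) := by
  induction m, h using Nat.le_induction with
  | base => exact fun x y h => by simpa using h
  | succ m h ih =>
    intro x y hxy
    rw [← B.p_comp h (Nat.le_succ m), ← B.p_comp h (Nat.le_succ m)] at hxy
    exact hB m (ih hxy)

/-- For `⇐`, the monomorphic tower is that of the images of the `B⁽ᵐ⁽ᵏ⁾⁾` in `B⁽ⁿ⁰⁾`, for a
sequence `m(k)` that increases fast enough. -/
theorem isEssentiallyMonomorphic_iff {B : Tower.{u} R} [∀ n, Countable (B.obj n)] :
    B.IsEssentiallyMonomorphic ↔ ∃ n₀, ∀ n, ∃ m, ∃ (h₀ : n₀ ≤ m) (h : n ≤ m),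
      ∀ y, B.p h₀ y = 0 → B.p h y = 0 := by
  constructor
  · rintro ⟨T, -, hT, f, g, ⟨m, -, hf, hg, h⟩, -⟩
    refine ⟨f.idx 0, fun n => ⟨m n, (f.mono (Nat.zero_le (g.idx n))).trans (hf n), hg n,
      fun y hy => ?_⟩⟩
    have hf' : f.idx (g.idx n) ≤ m n := hf n
    have h1 : f.app (g.idx n) (B.p hf' y) = 0 := by
      apply hT.injective_p (Nat.zero_le _)
      rw [f.comm_of_le, B.p_comp, hy, map_zero, map_zero]
    refine (h n y).symm.trans ?_
    change g.app n (f.app (g.idx n) (B.p hf' y)) = 0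
    rw [h1, map_zero]
  · rintro ⟨n₀, hE⟩
    choose M h₀M hM hker using hE
    obtain ⟨m, hm, hMm⟩ := exists_monotone_ge M
    have h₀ : ∀ k, n₀ ≤ m k := fun k => (h₀M k).trans (hMm k)
    have hk : ∀ k, k ≤ m k := fun k => (hM k).trans (hMm k)
    have hker' : ∀ k, LinearMap.ker (B.p (h₀ k)) ≤ LinearMap.ker (B.p (hk k)) := by
      intro k y hy
      rw [LinearMap.mem_ker] at hy ⊢
      rw [← B.p_comp (hM k) (hMm k)]
      exact hker k _ (by rw [B.p_comp, hy])
    have hle : ∀ {i j : ℕ}, i ≤ j →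
        LinearMap.range (B.p (h₀ j)) ≤ LinearMap.range (B.p (h₀ i)) := by
      rintro i j hij _ ⟨y, rfl⟩
      exact ⟨B.p (hm hij) y, by rw [B.p_comp]⟩
    let T : Tower.{u} R :=
      { obj := fun k => LinearMap.range (B.p (h₀ k))
        p := fun h => Submodule.inclusion (hle h)
        p_self := fun _ _ => rfl
        p_comp := fun _ _ _ => rfl }
    let φ : ∀ k, T.obj k →ₗ[R] B.obj k := fun k =>
      (LinearMap.ker (B.p (h₀ k))).liftQ (B.p (hk k)) (hker' k) ∘ₗ
        (B.p (h₀ k)).quotKerEquivRange.symm.toLinearMap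
    have hφ : ∀ k y, φ k ((B.p (h₀ k)).rangeRestrict y) = B.p (hk k) y := by
      intro k y
      change (LinearMap.ker (B.p (h₀ k))).liftQ (B.p (hk k)) (hker' k)
        ((B.p (h₀ k)).quotKerEquivRange.symm ⟨B.p (h₀ k) y, LinearMap.mem_range_self _ y⟩) = _
      rw [LinearMap.quotKerEquivRange_symm_apply_image]
      rfl
    refine ⟨T, fun k => inferInstanceAs (Countable (LinearMap.range (B.p (h₀ k)))),
      fun k => Submodule.inclusion_injective (hle (Nat.le_succ k)),
      ⟨m, hm, fun k => (B.p (h₀ k)).rangeRestrict, fun k x => Subtype.ext ?_⟩,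
      ⟨fun k => k, monotone_id, φ, fun k t => ?_⟩,
      ⟨m, hm, fun k => le_rfl, hk, fun k x => ?_⟩, ⟨m, hm, fun k => le_rfl, hk, fun k t => ?_⟩⟩
    · change B.p _ x = B.p _ (B.p _ x)
      rw [B.p_comp]
    · obtain ⟨y, rfl⟩ := (B.p (h₀ (k + 1))).surjective_rangeRestrict t
      have h1 : T.p (Nat.le_succ k) ((B.p (h₀ (k + 1))).rangeRestrict y) =
          (B.p (h₀ k)).rangeRestrict (B.p (hm (Nat.le_succ k)) y) := by
        refine Subtype.ext ?_
        change B.p _ y = B.p _ (B.p _ y)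
        rw [B.p_comp]
      change B.p _ (φ (k + 1) _) = φ k (T.p (Nat.le_succ k) _)
      rw [h1, hφ, hφ, B.p_comp, B.p_comp]
    · exact (hφ k _).trans (B.p_comp (hk k) le_rfl x)
    · obtain ⟨y, rfl⟩ := (B.p (h₀ (m k))).surjective_rangeRestrict t
      change (B.p (h₀ k)).rangeRestrict (φ (m k) ((B.p (h₀ (m k))).rangeRestrict y)) =
        T.p (hk k) ((B.p (h₀ (m k))).rangeRestrict y)
      rw [hφ]
      refine Subtype.ext ?_
      change B.p _ (B.p _ y) = B.p _ y
      rw [B.p_comp]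

variable (A : Tower.{u} R) (L : Ladder)

theorem lengthLE_iff {α : Ordinal.{0}} : A.LengthLE L α ↔
    ∀ n, ∃ m, ∃ h : n ≤ m, ∀ y ∈ A.derivedSub L α m, A.p h y = 0 := by
  rw [LengthLE, isIsomorphic_zero_iff]
  refine forall_congr' fun n => exists_congr fun m => exists_congr fun h => ?_
  exact ⟨fun H y hy => congrArg Subtype.val (H ⟨y, hy⟩), fun H y => Subtype.ext (H y.1 y.2)⟩

theorem isEssentiallyMonomorphic_derived_iff [∀ n, Countable (A.obj n)] {β : Ordinal.{0}} :
    (A.derived L β).IsEssentiallyMonomorphic ↔ ∃ n₀, A.EssMonoFrom (A.derivedSub L β) n₀ := by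
  rw [isEssentiallyMonomorphic_iff]
  refine exists_congr fun n₀ => forall_congr' fun n => exists_congr fun m => exists_congr fun h₀ =>
    exists_congr fun h => ?_
  exact ⟨fun H y hy h0 => congrArg Subtype.val (H ⟨y, hy⟩ (Subtype.ext h0)),
    fun H y h0 => Subtype.ext (H y.1 y.2 (congrArg Subtype.val h0))⟩

/-! ### The Solecki submodules of `lim¹` -/

theorem isDerivedOf_derivedSub (β : Ordinal.{0}) :
    A.IsDerivedOf (A.derivedSub L (β + 1)) (A.derivedSub L β) :=
  fun _ _ => A.mem_derivedSub_add_one L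

theorem quotReduced_derivedSub {α : Ordinal.{0}} (hα : α < ω₁) :
    A.QuotReduced (A.derivedSub L α) := fun _ he => A.mem_cochainsIn_derivedSub L hα he

theorem map_coboundarySat_eq_bot_iff {D : ∀ n, Submodule R (A.obj n)} :
    (A.coboundarySat D).map A.B1.mkQ = ⊥ ↔ A.cocyclesIn D ≤ A.B1 := by
  rw [eq_bot_iff, Submodule.map_le_iff_le_comap, Submodule.comap_bot, Submodule.ker_mkQ,
    coboundarySat]
  exact ⟨fun h => le_sup_left.trans h, fun h => sup_le h le_rfl⟩

theorem inclZ1_mem_cocyclesIn {D : ∀ n, Submodule R (A.obj n)}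
    (hD : ∀ {n m : ℕ} (h : n ≤ m), ∀ x ∈ D m, A.p h x ∈ D n) (c : (A.subtower D hD).Z1) :
    A.inclZ1 D hD c ∈ A.cocyclesIn D :=
  mem_cocyclesIn.2 fun {n m} h => (c.1 ⟨(n, m), h⟩ : D n).2

theorem range_inclZ1 {D : ∀ n, Submodule R (A.obj n)}
    (hD : ∀ {n m : ℕ} (h : n ≤ m), ∀ x ∈ D m, A.p h x ∈ D n) :
    LinearMap.range (A.inclZ1 D hD) = A.cocyclesIn D := by
  refine le_antisymm ?_ fun c hc => ?_
  · rintro _ ⟨c, rfl⟩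
    exact A.inclZ1_mem_cocyclesIn hD c
  · refine ⟨⟨fun l => ⟨A.coef l.2 c, mem_cocyclesIn.1 hc l.2⟩, ?_⟩, rfl⟩
    have h : A.d2 c.1 = 0 := LinearMap.mem_ker.1 c.2
    exact LinearMap.mem_ker.2 (funext fun l => Subtype.ext (congrFun h l))

variable [∀ n, Countable (A.obj n)]

variable {A} in
theorem firstSolecki_coboundarySat {D D' : ∀ n, Submodule R (A.obj n)} (hD : A.IsSubtower D)
    (hD' : A.IsSubtower D') (hq : A.QuotReduced D) (hq' : A.QuotReduced D')
    (hDD : A.IsDerivedOf D' D) :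
    firstSolecki A.B1 (A.coboundarySat D) = A.coboundarySat D' := by
  have := A.isPolishModule_Z1.polish
  refine le_antisymm (sInf_le ⟨B1_le_coboundarySat,
    sup_le_sup_right (cocyclesIn_mono hDD.le) _, isPolishable_coboundarySat hD' hq', ?_⟩)
    (le_sInf ?_)
  · rw [isPi03In_iff_preimage (isPolishModule_satModel hD) (continuous_satModelFst hD)
      (satModelFst_injective hD hq) (range_satModelFst hD),
      preimage_coboundarySat_eq_iInter hD hq hDD]
    exact ⟨_, fun n => isSigma02_iUnion_of_isClosed fun x => isClosed_approxSet hD n x, rfl⟩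
  · rintro K ⟨hK, -, -, hPi⟩
    rw [isPi03In_iff_preimage (isPolishModule_satModel hD) (continuous_satModelFst hD)
      (satModelFst_injective hD hq) (range_satModelFst hD)] at hPi
    exact sup_le (cocyclesIn_le_of_isPi03 hD hDD hK
      (hPi.preimage (continuous_cocyclesInToSatModel hD))) hK

theorem soleckiCover_lim1 {α : Ordinal.{0}} (hα : α < ω₁) :
    A.lim1.soleckiCover α = A.coboundarySat (A.derivedSub L α) := by
  induction α using WellFoundedLT.induction with
  | ind α ih =>
  rcases Ordinal.zero_or_succ_or_isSuccLimit α with rfl | ⟨β, rfl⟩ | hl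
  · have h1 : A.coboundarySat (A.derivedSub L 0) = ⊤ := by
      have h : A.derivedSub L 0 = fun _ => ⊤ := funext fun n => A.derivedSub_zero L n
      rw [coboundarySat, h, cocyclesIn_top, top_sup_eq]
    rw [h1]
    exact A.lim1.soleckiCover_zero dense_B1
  · rw [Order.succ_eq_add_one] at hα ⊢
    have hβ : β < ω₁ := (Order.lt_succ β).trans hα
    rw [ModuleWithPolishCover.soleckiCover, Ordinal.limitRecOn_add_one]
    change firstSolecki A.B1 (A.lim1.soleckiCover β) = _
    rw [ih β (Order.lt_succ β) hβ]
    exact firstSolecki_coboundarySat (A.isSubtower_derivedSub L β)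
      (A.isSubtower_derivedSub L (β + 1)) (A.quotReduced_derivedSub L hβ)
      (A.quotReduced_derivedSub L hα) (A.isDerivedOf_derivedSub L β)
  · rw [A.coboundarySat_derivedSub_limit L hl hα, ModuleWithPolishCover.soleckiCover,
      Ordinal.limitRecOn_limit _ _ _ _ hl]
    exact iInf_congr fun β => ih β.1 β.2 (β.2.trans hα)

theorem soleckiLengthLE_lim1_iff {α : Ordinal.{0}} (hα : α < ω₁) :
    A.lim1.SoleckiLengthLE α ↔ A.cocyclesIn (A.derivedSub L α) ≤ A.B1 := by
  constructor
  · rintro ⟨σ, hσ, h⟩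
    rw [ModuleWithPolishCover.solecki, A.soleckiCover_lim1 L (hσ.trans_lt hα)] at h
    rw [← map_coboundarySat_eq_bot_iff, eq_bot_iff, ← h]
    exact Submodule.map_mono (A.coboundarySat_derivedSub_anti L hα hσ)
  · intro h
    refine ⟨α, le_rfl, ?_⟩
    rw [ModuleWithPolishCover.solecki, A.soleckiCover_lim1 L hα]
    exact A.map_coboundarySat_eq_bot_iff.2 h

theorem range_inclLim1 {D : ∀ n, Submodule R (A.obj n)}
    (hD : ∀ {n m : ℕ} (h : n ≤ m), ∀ x ∈ D m, A.p h x ∈ D n) :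
    LinearMap.range (A.inclLim1 D hD) = (A.coboundarySat D).map A.B1.mkQ := by
  have h1 : A.B1.map A.B1.mkQ = ⊥ := by
    rw [eq_bot_iff, Submodule.map_le_iff_le_comap, Submodule.comap_bot, Submodule.ker_mkQ]
  rw [inclLim1, Submodule.range_mapQ, range_inclZ1, coboundarySat, Submodule.map_sup, h1,
    sup_bot_eq]

theorem inclLim1_injective {D : ∀ n, Submodule R (A.obj n)}
    (hD : ∀ {n m : ℕ} (h : n ≤ m), ∀ x ∈ D m, A.p h x ∈ D n) (hq : A.QuotReduced D) :
    Function.Injective (A.inclLim1 D hD) := by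
  rw [injective_iff_map_eq_zero]
  intro q h
  obtain ⟨c, rfl⟩ := Submodule.mkQ_surjective _ q
  have h1 : A.inclZ1 D hD c ∈ A.B1 := (Submodule.Quotient.mk_eq_zero _).1 h
  obtain ⟨e, he⟩ := h1
  have h2 : e ∈ A.cochainsIn D := hq e (he ▸ A.inclZ1_mem_cocyclesIn hD c)
  refine (Submodule.Quotient.mk_eq_zero _).2 ⟨fun n => ⟨e n, h2 n⟩, ?_⟩
  refine Subtype.ext (funext fun l => Subtype.ext ?_)
  exact congrFun (congrArg Subtype.val he) l

theorem lengthLE_iff_soleckiLengthLE {α : Ordinal.{0}} (hα : α < ω₁) (hA : A.IsReduced) :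
    A.LengthLE L α ↔ A.lim1.SoleckiLengthLE α := by
  have hD := A.isSubtower_derivedSub L α
  rw [lengthLE_iff, A.soleckiLengthLE_lim1_iff L hα]
  constructor
  · intro h c hc
    -- As the maps `D m → D 0` vanish for large `m`, so does `p c_{Mm}`, and `c_{0m} = c_{0M}`.
    have hE : A.EssMonoFrom (A.derivedSub L α) 0 := fun n => by
      obtain ⟨m, hm, h0⟩ := h n
      exact ⟨m, Nat.zero_le m, hm, fun y hy _ => h0 y hy⟩
    obtain ⟨M, hM, h0⟩ := h 0
    refine hE.mem_B1 hD hc (A.coef hM c) fun {m} hm => ?_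
    rcases le_total M m with hMm | hMm
    · exact ⟨0, zero_mem _, by
        rw [coef_trans hM hMm, h0 _ (mem_cocyclesIn.1 hc hMm), map_zero]⟩
    · exact ⟨-A.coef hMm c, neg_mem (mem_cocyclesIn.1 hc hMm), by
        rw [coef_trans hm hMm, map_neg, add_neg_cancel_right]⟩
  · intro h n
    obtain ⟨m, -, hm, h0⟩ := hA.exists_p_eq_zero hD 0 (fun c hc _ => h hc) n
    exact ⟨m, hm, fun y hy => h0 y hy fun _ hi => absurd hi (Nat.not_lt_zero _)⟩

theorem plainLengthLE_iff_plainSoleckiLengthLE {α : Ordinal.{0}} (hα : α < ω₁)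
    (hA : A.IsReduced) : A.PlainLengthLE L α ↔ A.lim1.PlainSoleckiLengthLE α := by
  have := A.isPolishModule_Z1.polish
  refine exists_congr fun β => and_congr_right ?_
  rintro rfl
  have hβ : β < ω₁ := (Order.lt_succ β).trans hα
  have hD := A.isSubtower_derivedSub L β
  have hq := A.quotReduced_derivedSub L hβ
  have hDD := A.isDerivedOf_derivedSub L β
  have hS := isSigma02In_iff_preimage (isPolishModule_satModel hD) (continuous_satModelFst hD)
    (satModelFst_injective hD hq) (range_satModelFst hD) (K := A.B1)
  rw [A.soleckiCover_lim1 L hβ, isEssentiallyMonomorphic_derived_iff]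
  change _ ↔ _ ∧ IsSigma02In A.B1 _
  rw [hS, A.soleckiLengthLE_lim1_iff L hα]
  constructor
  · rintro ⟨n₀, hE⟩
    have h1 : IsSigma02 (satModelFst hD ⁻¹' A.B1) := by
      rw [preimage_B1_eq_iUnion hD hq hDD hE]
      exact isSigma02_iUnion_of_isClosed fun x => isClosed_approxSet hD n₀ x
    exact ⟨cocyclesIn_le_of_isPi03 hD hDD le_rfl
      (h1.isPi03.preimage (continuous_cocyclesInToSatModel hD)), h1⟩
  · rintro ⟨-, h⟩
    exact hA.exists_essMonoFrom hD (h.preimage (continuous_cocyclesInToSatModel hD))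

end Tower

end

theorem mainTheorem5 {R : Type v} [CommRing R] [IsDomain R] [Countable R] (L : Tower.Ladder)
    (A : Tower.{u} R) [∀ n, Countable (A.obj n)] (α : Ordinal.{0}) (hα : α < ω₁) :
    (Function.Injective (A.derivedInclLim1 L α) ∧
      A.lim1.solecki α = LinearMap.range (A.derivedInclLim1 L α)) ∧
    (A.IsReduced → (A.LengthLE L α ↔ A.lim1.SoleckiLengthLE α)) ∧
    (A.IsReduced → (A.PlainLengthLE L α ↔ A.lim1.PlainSoleckiLengthLE α)) := by
  refine ⟨⟨A.inclLim1_injective (A.derivedSub_aux L α).1 (A.quotReduced_derivedSub L hα), ?_⟩,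
    A.lengthLE_iff_soleckiLengthLE L hα, A.plainLengthLE_iff_plainSoleckiLengthLE L hα⟩
  rw [ModuleWithPolishCover.solecki, A.soleckiCover_lim1 L hα]
  exact (A.range_inclLim1 (A.derivedSub_aux L α).1).symm
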